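/- Theorem 1. For $0<\epsilon<1$ and $n\ge 0$ let $P_n(t)=\prod_{j=0}^{n}(1+\epsilon\cos(3^jt))$. For each $n\ge1$ there is an integer $N_n\ge 0$ with $\|P_{N_n}\|_{1+1/n}\ge 4^n$ (norm in $L^{1+1/n}([0,2\pi),dx)$). For every such choice of $(N_n)_{n\ge1}$ put $$\tilde f=\sum_{n\ge1}2^{-n}\frac{P_{N_n}}{\|P_{N_n}\|_{L\log L}},\qquad \|g\|_{L\log L}=\int_0^{2\pi}|g|\log(e+|g|)\,dx ,$$ a $2\pi$-periodic function on $\mathbb R$ (the series converges almost everywhere), and let $\omega=M\tilde f$ be its Hardy–Littlewood maximal function, $M\tilde f(x)=\sup_{I\ni x}\frac1{|I|}\int_I|\tilde f|$, the supremum being over all bounded intervals $I\subset\mathbb R$ of positive length that contain $x$. Then $\tilde f\in L\log L([0,2\pi))$, but $\tilde f\notin L^p([0,2\pi))$ for every $p>1$. Moreover there is a sense-preserving homeomorphism $h$ of the unit circle $\mathbb S$ such that 1. $h$ is absolutely continuous, and $|h'(e^{ix})|=c\,\omega(x)$ for almost every $x$, for some constant $c>0$; 2. $|h'|$ is a doubling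 weight: there is $C>0$ with $C^{-1}\int_I|h'|\le\int_{I^*}|h'|\le C\int_I|h'|$ for all adjacent arcs $I,I^*\subset\mathbb S$ of equal length at most $\pi$; 3. $\log h'\in\mathrm{BMO}(\mathbb S)$, where $\log h'$ is a logarithm of $h'(e^{ix})=\frac{1}{ie^{ix}}\frac{d}{dx}h(e^{ix})$ with continuous imaginary part on $\mathbb S$; 4. $|h'|$ is not an $A_\infty$ weight, that is, the following fails: for each $\eta>0$ there is $\delta>0$ such that $|E|\le\delta|I|$ implies $\int_E|h'|\le\eta\int_I|h'|$ whenever $I\subset\mathbb S$ is an arc and $E\subset I$ is measurable. -/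

import Mathlib

open MeasureTheory

noncomputable section

/-- The partial Riesz product `P_n(t) = ∏_{j=0}^{n} (1 + ε cos(3^j t))`. -/
def rieszProd (ε : ℝ) (n : ℕ) (t : ℝ) : ℝ :=
  ∏ j ∈ Finset.range (n + 1), (1 + ε * Real.cos (3 ^ j * t))

/-- Lebesgue measure on the period `[0, 2π)`. -/
def periodMeasure : Measure ℝ := volume.restrict (Set.Ico 0 (2 * Real.pi))

/-- The function `|g| log (e + |g|)`. -/
def llogl (g : ℝ → ℝ) (x : ℝ) : ℝ := |g x| * Real.log (Real.exp 1 + |g x|)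

/-- The quantity `∫₀^{2π} |g| log (e + |g|)`. -/
def llogLNorm (g : ℝ → ℝ) : ℝ := ∫ x, llogl g x ∂periodMeasure

/-- The class `L log L` on `[0, 2π)`. -/
def MemLlogL (g : ℝ → ℝ) : Prop :=
  AEStronglyMeasurable g periodMeasure ∧ Integrable (llogl g) periodMeasure

/-- The sequence `N₁, N₂, …` (the value `N 0` plays no role) satisfies
`‖P_{N_n}‖_{1 + 1/n} ≥ 4 ^ n` for every `n ≥ 1`, with norms in `L^{1 + 1/n}([0, 2π), dx)`. -/
def FastGrowth (ε : ℝ) (N : ℕ → ℕ) : Prop :=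
  ∀ n : ℕ, 1 ≤ n →
    (4 : ENNReal) ^ n ≤
      eLpNorm (rieszProd ε (N n)) (ENNReal.ofReal (1 + 1 / (n : ℝ))) periodMeasure

/-- The term of index `n` of the normalized sum:
`2^{-n} P_{N_n}(x) / ‖P_{N_n}‖_{L log L}`. -/
def rieszTerm (ε : ℝ) (N : ℕ → ℕ) (n : ℕ) (x : ℝ) : ℝ :=
  (2 : ℝ)⁻¹ ^ n * (rieszProd ε (N n) x / llogLNorm (rieszProd ε (N n)))

/-- The normalized sum of Riesz products, `∑_{n ≥ 1} 2^{-n} P_{N_n} / ‖P_{N_n}‖_{L log L}`,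
as a `2π`-periodic function on the line. -/
def rieszSum (ε : ℝ) (N : ℕ → ℕ) (x : ℝ) : ℝ := ∑' n : ℕ, rieszTerm ε N (n + 1) x

/-- The (uncentred) Hardy–Littlewood maximal function on the line: the supremum of the means
of `|g|` over all bounded intervals that contain `x`. -/
def maximalFn (g : ℝ → ℝ) (x : ℝ) : ENNReal :=
  ⨆ (a : ℝ) (b : ℝ) (_ : a < b) (_ : x ∈ Set.Icc a b),
    (∫⁻ t in Set.Icc a b, ‖g t‖ₑ) / ENNReal.ofReal (b - a)

/-- A homeomorphism of the circle is sense-preserving if it lifts to an increasing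
continuous map of the line. -/
def SensePreserving (h : Circle ≃ₜ Circle) : Prop :=
  ∃ g : ℝ → ℝ, Continuous g ∧ StrictMono g ∧ ∀ x, h (Circle.exp x) = Circle.exp (g x)

/-- Absolute continuity of a circle homeomorphism, with respect to arc length. -/
def CircleAC (h : Circle ≃ₜ Circle) : Prop :=
  AbsolutelyContinuousOnInterval (fun x : ℝ => h (Circle.exp x)) 0 (2 * Real.pi)

/-- The derivative of `h` along the circle, `h'(z) = (d/dx) h(e^{ix}) / (i e^{ix})` at
`z = e^{ix}`. -/
def circleDeriv (h : Circle ≃ₜ Circle) (z : Circle) : ℂ :=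
  deriv (fun x : ℝ => (h (Circle.exp x) : ℂ)) (Complex.arg z) / (Complex.I * z)

/-- `L` is a branch of `log h'`: `exp L = h'` almost everywhere, with continuous argument
`Im L` on the circle. -/
def IsLogDeriv (h : Circle ≃ₜ Circle) (L : Circle → ℂ) : Prop :=
  (∀ᵐ x : ℝ, Complex.exp (L (Circle.exp x)) = circleDeriv h (Circle.exp x)) ∧
    Continuous fun z => (L z).im

/-- `u ∈ BMO(𝕊)`: `u` is integrable and its mean oscillations over arcs
`{e^{ix} : a < x < b}`, `b - a ≤ 2π`, are bounded. -/
def CircleBMO (u : Circle → ℂ) : Prop :=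
  Integrable (fun x : ℝ => u (Circle.exp x)) periodMeasure ∧
    ∃ C : ℝ, ∀ a b : ℝ, a < b → b ≤ a + 2 * Real.pi →
      (⨍ x in a..b, ‖u (Circle.exp x) - ⨍ y in a..b, u (Circle.exp y)‖) ≤ C

/-- A weight on the circle: a nonnegative integrable function that is not a.e. zero. -/
def IsWeight (w : Circle → ℝ) : Prop :=
  (∀ z, 0 ≤ w z) ∧ Integrable (fun x : ℝ => w (Circle.exp x)) periodMeasure ∧
    0 < ∫ x, w (Circle.exp x) ∂periodMeasure

/-- A doubling weight on the circle: the masses of any two adjacent arcs of the same length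
`t ≤ π` are comparable. -/
def IsDoublingWeight (w : Circle → ℝ) : Prop :=
  IsWeight w ∧ ∃ C : ℝ, 0 < C ∧ ∀ a t : ℝ, 0 < t → t ≤ Real.pi →
    C⁻¹ * (∫ x in a..(a + t), w (Circle.exp x)) ≤
        ∫ x in (a + t)..(a + 2 * t), w (Circle.exp x) ∧
      (∫ x in (a + t)..(a + 2 * t), w (Circle.exp x)) ≤
        C * ∫ x in a..(a + t), w (Circle.exp x)

/-- An `A_∞` (Muckenhoupt) weight on the circle: for each `η > 0` there is a `δ > 0` such that
`|E| ≤ δ |I|` implies `w(E) ≤ η w(I)` for every arc `I` and measurable `E ⊆ I`. -/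
def IsAInftyWeight (w : Circle → ℝ) : Prop :=
  IsWeight w ∧ ∀ η : ℝ, 0 < η → ∃ δ : ℝ, 0 < δ ∧
    ∀ a b : ℝ, a < b → b ≤ a + 2 * Real.pi → ∀ E : Set ℝ, MeasurableSet E → E ⊆ Set.Ioc a b →
      volume E ≤ ENNReal.ofReal (δ * (b - a)) →
        (∫ x in E, w (Circle.exp x)) ≤ η * ∫ x in a..b, w (Circle.exp x)

end

/-! Write `P_n` for the Riesz products, `f` for the normalized sum, `ω = M f`.

Ratio 3 acts twice. Averaging over translations by multiples of `2π/3` makes the mean of a product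
of factors `c(3^j t)` the product of the means whenever `c` has constant three-point averages. So `∫
P_n` stays `2π` while `∫ √P_n` decays exponentially: the mass concentrates where `P_n` is large, and
the `L^q` norms are unbounded for every `q > 1`. Moreover translation by `2π/3^k` fixes the factors
with `j ≥ k` and changes the product of the others by at most `exp(πε/(1-ε))`, whatever `n` and `k`.
This quasi-invariance passes to `f` and to `ω`; since an interval is covered by three such
translates of its neighbour, `ω` is doubling (`setLIntegral_Ioc_add_le_of_quasiInvariant`).

Convexity of `u log(e+u)` puts `f` in `L log L`. Comparing the logarithm with a small power shows
that the `L log L` norm of `P_{N_n}` is at most `100 n` times the fourth root of its `L^{1+1/n}`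
norm, so the normalization cannot undo the growth `4^n`, and `f` lies in no `L^p` with `p > 1`
(`not_memLp_rieszSum`).

The maximal function of an `L log L` function is locally integrable (`setLIntegral_avgSup_ne_top`),
and the logarithm of a maximal function has bounded mean oscillation (`setLIntegral_log_avgSup_le`).
With `G` the primitive of `c ω` of degree one and `h(e^{ix}) = e^{iG(x)}`, a logarithm of `h'` is
`log(c ω) + i(G(x) - x)`, whose imaginary part is continuous and periodic, hence bounded.

If `ω` were `A_∞`, it would improve itself (`exists_setLIntegral_rpow_ne_top`). At the end points of
a component of `{ω > l}` one has `ω ≤ l`, so inside it only the values of `f` there matter for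
higher levels, and the weak type bound makes the part where `ω > K l` a fraction at most `5/K` of
the component. By `A_∞` this part carries at most half of the mass. The masses of the level sets
thus decay geometrically and `ω ∈ L^{1+s}` for some `s > 0`, which `f ≤ ω` forbids. -/

/-! ### The maximal function on the line: semicontinuity, weak type, localization. -/

section maximal
open Set Filter Topology
open scoped ENNReal

/-- The uncentred maximal function of a function with values in `[0, ∞]`. -/
noncomputable def avgSup (F : ℝ → ℝ≥0∞) (x : ℝ) : ℝ≥0∞ :=
  ⨆ (a : ℝ) (b : ℝ) (_ : a < b) (_ : x ∈ Icc a b),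
    (∫⁻ t in Icc a b, F t) / ENNReal.ofReal (b - a)

theorem maximalFn_eq_avgSup (g : ℝ → ℝ) : maximalFn g = avgSup fun x => ‖g x‖ₑ := rfl

theorem lt_avgSup_iff {F : ℝ → ℝ≥0∞} {l : ℝ≥0∞} {x : ℝ} :
    l < avgSup F x ↔ ∃ a b, a < b ∧ x ∈ Icc a b ∧
      l * ENNReal.ofReal (b - a) < ∫⁻ t in Icc a b, F t := by
  simp only [avgSup, lt_iSup_iff, exists_prop]
  refine exists_congr fun a => exists_congr fun b => and_congr_right fun hab =>
    and_congr_right fun _ => ?_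
  rw [ENNReal.lt_div_iff_mul_lt]
  · left; simpa using hab
  · left; simp

theorem lintegral_Icc_le_avgSup_mul {F : ℝ → ℝ≥0∞} {a b x : ℝ} (hab : a < b)
    (hx : x ∈ Icc a b) :
    ∫⁻ t in Icc a b, F t ≤ avgSup F x * ENNReal.ofReal (b - a) := by
  by_contra! h
  exact lt_irrefl _ (lt_avgSup_iff.2 ⟨a, b, hab, hx, h⟩)

theorem avgSup_le_iff {F : ℝ → ℝ≥0∞} {l : ℝ≥0∞} {x : ℝ} :
    avgSup F x ≤ l ↔ ∀ a b, a < b → x ∈ Icc a b →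
      ∫⁻ t in Icc a b, F t ≤ l * ENNReal.ofReal (b - a) := by
  rw [← not_lt, lt_avgSup_iff]
  push Not
  rfl

theorem isOpen_lt_avgSup (F : ℝ → ℝ≥0∞) (l : ℝ≥0∞) : IsOpen {x | l < avgSup F x} := by
  rw [isOpen_iff_mem_nhds]
  intro x hx
  have hl : l ≠ ∞ := (lt_of_lt_of_le hx le_top).ne
  obtain ⟨a, b, hab, hxab, h⟩ := lt_avgSup_iff.1 hx
  have hc : Continuous fun e : ℝ => l * ENNReal.ofReal (b + e - (a - e)) :=
    (ENNReal.continuous_const_mul hl).comp (ENNReal.continuous_ofReal.comp (by fun_prop))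
  -- The point may be an end point of its interval. The strict inequality survives a slight
  -- enlargement on both sides, and the enlarged interval serves a whole neighbourhood.
  have h0 : ∀ᶠ e : ℝ in 𝓝 0, l * ENNReal.ofReal (b + e - (a - e)) < ∫⁻ t in Icc a b, F t :=
    hc.continuousAt.eventually_lt continuousAt_const (by simpa using h)
  obtain ⟨e, he, hpos⟩ := ((h0.filter_mono nhdsWithin_le_nhds).and
    (self_mem_nhdsWithin : Ioi (0 : ℝ) ∈ 𝓝[>] 0)).exists
  have hpos : 0 < e := hpos
  refine mem_of_superset (Ioo_mem_nhds (a := a - e) (b := b + e) ?_ ?_) fun y hy => ?_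
  · linarith [hxab.1]
  · linarith [hxab.2]
  · refine lt_avgSup_iff.2 ⟨a - e, b + e, by linarith, ⟨hy.1.le, hy.2.le⟩, he.trans_le ?_⟩
    exact lintegral_mono_set (Icc_subset_Icc (by linarith) (by linarith))

theorem measurable_avgSup (F : ℝ → ℝ≥0∞) : Measurable (avgSup F) :=
  measurable_of_Ioi fun l => (isOpen_lt_avgSup F l).measurableSet

/-- The weak type `(1, 1)` inequality. -/
theorem mul_volume_lt_avgSup_le (F : ℝ → ℝ≥0∞) (l : ℝ≥0∞) :
    l * volume {x | l < avgSup F x} ≤ 5 * ∫⁻ x, F x := by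
  rcases eq_or_ne (∫⁻ x, F x) ∞ with hF | hF
  · simp [hF]
  rcases eq_or_ne l 0 with rfl | hl
  · simp
  rcases eq_or_ne l ∞ with rfl | hl'
  · simp
  let t : Set (ℝ × ℝ) := {p | p.1 < p.2 ∧
    l * ENNReal.ofReal (p.2 - p.1) < ∫⁻ x in Icc p.1 p.2, F x}
  have hball : ∀ p : ℝ × ℝ,
      Metric.closedBall ((p.1 + p.2) / 2) ((p.2 - p.1) / 2) = Icc p.1 p.2 := by
    intro p
    rw [Real.closedBall_eq_Icc]
    congr 1 <;> ring
  -- Vitali's lemma for the intervals with mean above `l`, viewed as closed balls. Their lengths are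
  -- bounded by `(∫ F) / l`; the enlargement factor 5 is the constant of the weak type bound.
  obtain ⟨u, hut, hdisj, hcov⟩ := Vitali.exists_disjoint_subfamily_covering_enlargement_closedBall
    t (fun p => (p.1 + p.2) / 2) (fun p => (p.2 - p.1) / 2)
    (((∫⁻ x, F x) / l).toReal) (by
      intro p hp
      have h1 : ENNReal.ofReal (p.2 - p.1) ≤ (∫⁻ x, F x) / l := by
        rw [ENNReal.le_div_iff_mul_le (Or.inl hl) (Or.inl hl'), mul_comm]
        exact hp.2.le.trans (setLIntegral_le_lintegral _ _)
      have h2 := (ENNReal.ofReal_le_iff_le_toReal (ENNReal.div_ne_top hF hl)).1 h1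
      have := hp.1
      linarith) 5 (by norm_num)
  simp only [hball] at hdisj hcov
  have hdisj' : u.PairwiseDisjoint fun p : ℝ × ℝ => Icc p.1 p.2 := hdisj
  have hcount : u.Countable := by
    refine PairwiseDisjoint.countable_of_isOpen (s := fun p : ℝ × ℝ => Ioo p.1 p.2) ?_
      (fun _ _ => isOpen_Ioo) fun p hp => nonempty_Ioo.2 (hut hp).1
    exact hdisj'.mono fun p => Ioo_subset_Icc_self
  have hsub : {x | l < avgSup F x} ⊆
      ⋃ p ∈ u, Metric.closedBall ((p.1 + p.2) / 2) (5 * ((p.2 - p.1) / 2)) := by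
    intro x hx
    obtain ⟨a, b, hab, hxab, h⟩ := lt_avgSup_iff.1 hx
    obtain ⟨p, hp, hp'⟩ := hcov (a, b) ⟨hab, h⟩
    exact mem_biUnion hp (hp' hxab)
  have : Countable u := hcount
  calc l * volume {x | l < avgSup F x}
      ≤ l * ∑' p : u, volume (Metric.closedBall ((p.1.1 + p.1.2) / 2)
          (5 * ((p.1.2 - p.1.1) / 2))) := by
        gcongr
        exact (measure_mono hsub).trans (measure_biUnion_le _ hcount _)
    _ = ∑' p : u, 5 * (l * ENNReal.ofReal (p.1.2 - p.1.1)) := by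
        rw [← ENNReal.tsum_mul_left]
        refine tsum_congr fun p => ?_
        rw [Real.volume_closedBall, show 2 * (5 * ((p.1.2 - p.1.1) / 2)) =
          5 * (p.1.2 - p.1.1) by ring, ENNReal.ofReal_mul (by norm_num)]
        simp only [ENNReal.ofReal_ofNat]
        ring
    _ ≤ ∑' p : u, 5 * ∫⁻ x in Icc p.1.1 p.1.2, F x := by
        gcongr with p
        exact (hut p.2).2.le
    _ = 5 * ∫⁻ x in ⋃ p : u, Icc p.1.1 p.1.2, F x := by
        rw [ENNReal.tsum_mul_left, lintegral_iUnion (fun p => measurableSet_Icc)]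
        intro p q hpq
        exact hdisj' p.2 q.2 (fun h => hpq (Subtype.ext h))
    _ ≤ 5 * ∫⁻ x, F x := by
        gcongr
        exact Measure.restrict_le_self

theorem lintegral_Icc_sub (F : ℝ → ℝ≥0∞) (a b τ : ℝ) :
    ∫⁻ t in Icc (a - τ) (b - τ), F (t + τ) = ∫⁻ t in Icc a b, F t := by
  have h := (measurePreserving_add_right (volume : Measure ℝ) τ).setLIntegral_comp_preimage_emb
    (measurableEmbedding_addRight τ) F (Icc a b)
  rw [← h]
  congr 2
  ext; simp [le_sub_iff_add_le]

/-- Quasi-invariance under a translation passes to the maximal function. -/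
theorem avgSup_add_le {F : ℝ → ℝ≥0∞} {C : ℝ≥0∞} {τ : ℝ} (hC : C ≠ ∞)
    (h : ∀ t, F (t + τ) ≤ C * F t) (x : ℝ) : avgSup F (x + τ) ≤ C * avgSup F x := by
  rw [avgSup_le_iff]
  intro a b hab hx
  calc ∫⁻ t in Icc a b, F t = ∫⁻ t in Icc (a - τ) (b - τ), F (t + τ) :=
        (lintegral_Icc_sub F a b τ).symm
    _ ≤ ∫⁻ t in Icc (a - τ) (b - τ), C * F t := lintegral_mono h
    _ = C * ∫⁻ t in Icc (a - τ) (b - τ), F t := lintegral_const_mul' _ _ hC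
    _ ≤ C * (avgSup F x * ENNReal.ofReal ((b - τ) - (a - τ))) := by
        gcongr
        exact lintegral_Icc_le_avgSup_mul (by linarith)
          ⟨by linarith [hx.1], by linarith [hx.2]⟩
    _ = C * avgSup F x * ENNReal.ofReal (b - a) := by
        rw [mul_assoc]; congr 3; ring

/-- On an interval, the maximal function is controlled by its infimum and by the maximal function
of the localization to the threefold interval. -/
theorem avgSup_le_of_two_mul_lt {F : ℝ → ℝ≥0∞} {a b x y : ℝ} (hx : x ∈ Icc a b)
    (hy : y ∈ Icc a b) (h : 2 * avgSup F y < avgSup F x) :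
    avgSup F x ≤ avgSup ((Icc (a - (b - a)) (b + (b - a))).indicator F) x := by
  refine le_of_forall_lt fun l hl => ?_
  obtain ⟨p, q, hpq, hxpq, hlt⟩ := lt_avgSup_iff.1 (max_lt h hl)
  -- An interval through `x` at least as long as `[a, b]` could be stretched to contain `y` at no
  -- more than twice its length, so its mean would be at most `2 * avgSup F y`. Hence only shorter
  -- intervals compete, and these stay in the threefold interval.
  have hlen : q - p < b - a := by
    by_contra! hlen
    have h1 : ∫⁻ t in Icc p q, F t ≤ ∫⁻ t in Icc (min a p) (max b q), F t :=
      lintegral_mono_set (Icc_subset_Icc (min_le_right _ _) (le_max_right _ _))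
    have h2 : ∫⁻ t in Icc (min a p) (max b q), F t ≤
        avgSup F y * ENNReal.ofReal (max b q - min a p) :=
      lintegral_Icc_le_avgSup_mul ((min_le_right _ _).trans_lt (hpq.trans_le (le_max_right _ _)))
        ⟨(min_le_left _ _).trans hy.1, hy.2.trans (le_max_left _ _)⟩
    have h3 : ENNReal.ofReal (max b q - min a p) ≤ 2 * ENNReal.ofReal (q - p) := by
      rw [← ENNReal.ofReal_ofNat, ← ENNReal.ofReal_mul (by norm_num)]
      refine ENNReal.ofReal_le_ofReal ?_
      have := hx.1; have := hx.2; have := hxpq.1; have := hxpq.2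
      rcases max_choice b q with h | h <;> rcases min_choice a p with h' | h' <;>
        rw [h, h'] <;> linarith
    have h4 : max (2 * avgSup F y) l * ENNReal.ofReal (q - p) ≥
        avgSup F y * (2 * ENNReal.ofReal (q - p)) := by
      rw [← mul_assoc, mul_comm (avgSup F y)]
      gcongr
      exact le_max_left _ _
    exact absurd (h1.trans (h2.trans ((mul_le_mul_right h3 _).trans h4))) (not_le.2 hlt)
  refine lt_avgSup_iff.2 ⟨p, q, hpq, hxpq, ?_⟩
  rw [setLIntegral_indicator measurableSet_Icc, inter_eq_self_of_subset_right]
  · refine lt_of_le_of_lt ?_ hlt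
    gcongr
    exact le_max_right _ _
  · have := hx.1; have := hx.2; have := hxpq.1; have := hxpq.2
    exact Icc_subset_Icc (by linarith) (by linarith)

/-! ### Layer-cake sums; the `L log L` theorem; the logarithm of a maximal function. -/

/-- Layer-cake bound along an increasing unbounded sequence of levels. -/
theorem le_add_tsum_of_levels {a d : ℕ → ℝ≥0∞} (had : ∀ k, a (k + 1) = a k + d k)
    (ha : ∀ R : ℝ≥0∞, R ≠ ∞ → ∃ k, R < a k) (u : ℝ≥0∞) :
    u ≤ a 0 + ∑' k, if a k < u then d k else 0 := by
  have key : ∀ K, min u (a K) ≤ a 0 + ∑ k ∈ Finset.range K, if a k < u then d k else 0 := by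
    intro K
    induction K with
    | zero => simp
    | succ K ih =>
      rw [Finset.sum_range_succ, ← add_assoc]
      by_cases h : a K < u
      · rw [min_eq_right h.le] at ih
        rw [if_pos h]
        calc min u (a (K + 1)) ≤ a K + d K := (min_le_right _ _).trans (had K).le
          _ ≤ _ := by gcongr
      · rw [min_eq_left (not_lt.1 h)] at ih
        exact (min_le_left _ _).trans (ih.trans le_self_add)
  by_contra! hlt
  obtain ⟨k, hk⟩ := ha _ (hlt.trans_le le_top).ne
  refine absurd (key k) (not_le.2 (lt_of_le_of_lt ?_ (lt_min hlt hk)))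
  gcongr
  exact ENNReal.sum_le_tsum _

/-- Serves three times: with dyadic levels for `L log L`, with integer levels for the logarithm, and
with geometric levels and the measure `ω dx` for higher integrability. -/
theorem lintegral_le_tsum_levels {α : Type*} [MeasurableSpace α] (μ : Measure α)
    {a d : ℕ → ℝ≥0∞} (had : ∀ k, a (k + 1) = a k + d k)
    (ha : ∀ R : ℝ≥0∞, R ≠ ∞ → ∃ k, R < a k) {u : α → ℝ≥0∞} (hu : Measurable u) :
    ∫⁻ x, u x ∂μ ≤ a 0 * μ univ + ∑' k, d k * μ {x | a k < u x} := by
  have hm : ∀ k, MeasurableSet {x | a k < u x} := fun k => measurableSet_lt measurable_const hu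
  calc ∫⁻ x, u x ∂μ
      ≤ ∫⁻ x, (a 0 + ∑' k, {x | a k < u x}.indicator (fun _ => d k) x) ∂μ := by
        refine lintegral_mono fun x => ?_
        simpa [indicator] using le_add_tsum_of_levels had ha (u x)
    _ = a 0 * μ univ + ∑' k, d k * μ {x | a k < u x} := by
        rw [lintegral_add_left measurable_const, lintegral_const, lintegral_tsum]
        · congr 1
          exact tsum_congr fun k => lintegral_indicator_const (hm k) _
        · exact fun k => (measurable_const.indicator (hm k)).aemeasurable

theorem exists_lt_const_mul_pow {c r : ℝ≥0∞} (hc : c ≠ 0) (hr : 1 < r) {R : ℝ≥0∞}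
    (hR : R ≠ ∞) : ∃ k : ℕ, R < c * r ^ k := by
  rcases eq_or_ne c ∞ with rfl | hc'
  · exact ⟨0, by simpa using hR.lt_top⟩
  have h := ENNReal.tendsto_pow_atTop_nhds_top_iff.2 hr
  obtain ⟨k, hk⟩ := (h.eventually (lt_mem_nhds (ENNReal.div_lt_top hR hc))).exists
  refine ⟨k, ?_⟩
  rw [mul_comm]
  exact (ENNReal.div_lt_iff (Or.inl hc) (Or.inl hc')).1 hk

/-- The part of `F` below height `l` adds at most `l` to any mean. Truncating before the weak type
bound is what makes the sum over levels converge for `L log L` functions. -/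
theorem lt_avgSup_indicator_of_two_mul_lt {F : ℝ → ℝ≥0∞} {l : ℝ≥0∞}
    {x : ℝ} (h : 2 * l < avgSup F x) : l < avgSup ({t | l < F t}.indicator F) x := by
  obtain ⟨a, b, hab, hx, hlt⟩ := lt_avgSup_iff.1 h
  refine lt_avgSup_iff.2 ⟨a, b, hab, hx, ?_⟩
  have hl : l ≠ ∞ := by rintro rfl; simp at h
  have h1 : ∫⁻ t in Icc a b, F t ≤
      l * ENNReal.ofReal (b - a) + ∫⁻ t in Icc a b, {t | l < F t}.indicator F t := by
    calc ∫⁻ t in Icc a b, F t ≤ ∫⁻ t in Icc a b, (l + {t | l < F t}.indicator F t) := by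
          refine lintegral_mono fun t => ?_
          by_cases ht : l < F t
          · simp [indicator, ht]
          · simpa [indicator, ht] using not_lt.1 ht
      _ = _ := by
          rw [lintegral_add_left measurable_const]
          simp
  rw [two_mul, add_mul] at hlt
  exact lt_of_add_lt_add_left (hlt.trans_le h1)

/-- Counting the dyadic levels below `v` is where the logarithm of `L log L` comes from. -/
theorem tsum_pow_lt_le_log (v : ℝ) (hv : 0 ≤ v) :
    ∑' k : ℕ, (if (2 : ℝ≥0∞) ^ k < ENNReal.ofReal v then (1 : ℝ≥0∞) else 0) ≤
      ENNReal.ofReal (3 * Real.log (Real.exp 1 + v)) := by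
  have hpow : ∀ k : ℕ, (2 : ℝ≥0∞) ^ k < ENNReal.ofReal v ↔ (2 : ℝ) ^ k < v := by
    intro k
    rw [← ENNReal.ofReal_ofNat, ← ENNReal.ofReal_pow (by norm_num),
      ENNReal.ofReal_lt_ofReal_iff_of_nonneg (by positivity)]
  simp only [hpow]
  have he := Real.exp_pos 1
  have h1 : 1 ≤ Real.log (Real.exp 1 + v) := by
    rw [Real.le_log_iff_exp_le (by positivity)]; linarith
  by_cases hv1 : v ≤ 1
  · have : ∀ k : ℕ, ¬ (2 : ℝ) ^ k < v := fun k =>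
      not_lt.2 (hv1.trans (one_le_pow₀ (by norm_num)))
    simp [this]
  push Not at hv1
  have hlogb : 0 ≤ Real.logb 2 v := Real.logb_nonneg (by norm_num) hv1.le
  have hk : ∀ k : ℕ, k ∉ Finset.range (⌊Real.logb 2 v⌋₊ + 1) → ¬ (2 : ℝ) ^ k < v := by
    intro k hk h
    apply hk
    rw [Finset.mem_range, Nat.lt_succ_iff]
    refine Nat.le_floor ?_
    rw [Real.le_logb_iff_rpow_le (by norm_num) (by linarith)]
    simpa using h.le
  rw [tsum_eq_sum (s := Finset.range (⌊Real.logb 2 v⌋₊ + 1)) (fun k h => if_neg (hk k h))]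
  calc ∑ k ∈ Finset.range (⌊Real.logb 2 v⌋₊ + 1),
        (if (2 : ℝ) ^ k < v then (1 : ℝ≥0∞) else 0)
      ≤ ∑ k ∈ Finset.range (⌊Real.logb 2 v⌋₊ + 1), (1 : ℝ≥0∞) := by
        gcongr; split_ifs <;> simp
    _ = ENNReal.ofReal ((⌊Real.logb 2 v⌋₊ : ℝ) + 1) := by
        rw [ENNReal.ofReal_add (by positivity) (by norm_num)]; simp
    _ ≤ _ := by
        refine ENNReal.ofReal_le_ofReal ?_
        have h2 := Nat.floor_le hlogb
        have h3 : Real.logb 2 v ≤ 2 * Real.log (Real.exp 1 + v) := by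
          rw [Real.logb, div_le_iff₀ (Real.log_pos (by norm_num))]
          have h4 : Real.log v ≤ Real.log (Real.exp 1 + v) :=
            Real.log_le_log (by linarith) (by linarith)
          nlinarith [Real.log_two_gt_d9]
        linarith

/-- The maximal function of an `L log L` function is integrable over sets of finite measure. -/
theorem setLIntegral_avgSup_ne_top {g : ℝ → ℝ} (hg : AEMeasurable g)
    (hint : ∫⁻ x, ENNReal.ofReal (llogl g x) ≠ ∞) {W : Set ℝ} (hW : volume W ≠ ∞) :
    ∫⁻ x in W, avgSup (fun t => ‖g t‖ₑ) x ≠ ∞ := by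
  set F : ℝ → ℝ≥0∞ := fun t => ‖g t‖ₑ with hFdef
  have hF : AEMeasurable F := hg.enorm
  have hsets : ∀ k : ℕ, NullMeasurableSet {t | (2 : ℝ≥0∞) ^ k < F t} := fun k =>
    nullMeasurableSet_lt aemeasurable_const hF
  have hlev := lintegral_le_tsum_levels (volume.restrict W) (a := fun k => (2 : ℝ≥0∞) * 2 ^ k)
    (d := fun k => 2 * 2 ^ k) (fun k => by ring)
    (fun R hR => exists_lt_const_mul_pow (by norm_num) (by norm_num) hR) (measurable_avgSup F)
  -- Weak type at level `2^k` for the truncation above `2^k`. After summing over `k` and exchanging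
  -- sum and integral, `F x` is multiplied by the number of levels below it. The lowest level
  -- contributes `2 |W|`, which needs `W` of finite measure.
  have hterm : ∀ k : ℕ, 2 * 2 ^ k * volume.restrict W {x | 2 * 2 ^ k < avgSup F x} ≤
      10 * ∫⁻ x, {t | (2 : ℝ≥0∞) ^ k < F t}.indicator F x := by
    intro k
    calc 2 * 2 ^ k * volume.restrict W {x | 2 * 2 ^ k < avgSup F x}
        ≤ 2 * (2 ^ k * volume {x | 2 ^ k < avgSup ({t | (2 : ℝ≥0∞) ^ k < F t}.indicator F) x}) := by
          rw [mul_assoc]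
          refine mul_le_mul_right (mul_le_mul_right ?_ _) _
          refine (Measure.restrict_apply_le _ _).trans (measure_mono fun x hx => ?_)
          exact lt_avgSup_indicator_of_two_mul_lt hx
      _ ≤ 2 * (5 * ∫⁻ x, {t | (2 : ℝ≥0∞) ^ k < F t}.indicator F x) := by
          exact mul_le_mul_right (mul_volume_lt_avgSup_le _ _) _
      _ = _ := by rw [← mul_assoc]; norm_num
  refine ne_top_of_le_ne_top ?_ (hlev.trans (add_le_add le_rfl (ENNReal.tsum_le_tsum hterm)))
  refine ENNReal.add_ne_top.2 ⟨ENNReal.mul_ne_top (by simp) (by simpa using hW), ?_⟩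
  rw [ENNReal.tsum_mul_left, ← lintegral_tsum fun k => hF.indicator₀ (hsets k)]
  refine ENNReal.mul_ne_top (by simp) (ne_top_of_le_ne_top (ENNReal.mul_ne_top
    (ENNReal.ofReal_ne_top (r := 3)) hint) ?_)
  rw [← lintegral_const_mul' _ _ ENNReal.ofReal_ne_top]
  refine lintegral_mono fun x => ?_
  have h1 : ∀ k : ℕ, {t | (2 : ℝ≥0∞) ^ k < F t}.indicator F x =
      F x * (if (2 : ℝ≥0∞) ^ k < ENNReal.ofReal |g x| then (1 : ℝ≥0∞) else 0) := by
    intro k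
    have : F x = ENNReal.ofReal |g x| := Real.enorm_eq_ofReal_abs _
    rw [← this]
    by_cases h : (2 : ℝ≥0∞) ^ k < F x <;> simp [h]
  simp only [h1]
  rw [ENNReal.tsum_mul_left]
  calc _ ≤ F x * ENNReal.ofReal (3 * Real.log (Real.exp 1 + |g x|)) := by
        gcongr; exact tsum_pow_lt_le_log _ (abs_nonneg _)
    _ = _ := by
        rw [show F x = ENNReal.ofReal |g x| from Real.enorm_eq_ofReal_abs _, llogl,
          ← ENNReal.ofReal_mul (abs_nonneg _), ← ENNReal.ofReal_mul (by norm_num)]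
        congr 1; ring

/-- The logarithm of a maximal function has bounded mean oscillation. -/
theorem setLIntegral_log_avgSup_le (F : ℝ → ℝ≥0∞) {a b : ℝ} (hab : a < b) {m : ℝ≥0∞}
    (hm : m = ⨅ y ∈ Icc a b, avgSup F y) (hm0 : m ≠ 0) (hmt : m ≠ ∞) :
    ∫⁻ x in Icc a b, ENNReal.ofReal (Real.log (avgSup F x / m).toReal) ≤
      16 * ENNReal.ofReal (b - a) := by
  set F₁ := (Icc (a - (b - a)) (b + (b - a))).indicator F with hF₁
  have hmeas : Measurable fun x => ENNReal.ofReal (Real.log (avgSup F x / m).toReal) :=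
    (Real.measurable_log.comp ((measurable_avgSup F).div_const m).ennreal_toReal).ennreal_ofReal
  have hlev := lintegral_le_tsum_levels (volume.restrict (Icc a b))
    (a := fun k => ((k + 1 : ℕ) : ℝ≥0∞)) (d := fun _ => 1) (fun k => by push_cast; rfl)
    (fun R hR => by
      obtain ⟨n, hn⟩ := ENNReal.exists_nat_gt hR
      exact ⟨n, hn.trans_le (by exact_mod_cast Nat.le_succ n)⟩) hmeas
  -- The threefold interval contains every `y ∈ [a, b]`, so the mean of `F` over it is at most each
  -- `avgSup F y`, hence at most `m`.
  have hF1 : ∫⁻ x, F₁ x ≤ m * ENNReal.ofReal (3 * (b - a)) := by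
    rw [hF₁, lintegral_indicator measurableSet_Icc,
      ← ENNReal.div_le_iff_le_mul (Or.inl (by simpa using hab)) (Or.inl ENNReal.ofReal_ne_top), hm]
    refine le_iInf₂ fun y hy => ?_
    rw [ENNReal.div_le_iff_le_mul (Or.inl (by simpa using hab)) (Or.inl ENNReal.ofReal_ne_top)]
    have h := lintegral_Icc_le_avgSup_mul (F := F) (a := a - (b - a)) (b := b + (b - a)) (x := y)
      (by linarith) ⟨by linarith [hy.1], by linarith [hy.2]⟩
    rwa [show b + (b - a) - (a - (b - a)) = 3 * (b - a) by ring] at h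
  -- The logarithm exceeds `k + 1` only where the ratio exceeds `2^(k+1)`. There the maximal
  -- function is that of the localization, and `15 = 5 · 3` is the weak type constant times the
  -- threefold length. The geometric series sums to 15, and the lowest level adds 1, for 16 in all.
  have hterm : ∀ k : ℕ, 1 * volume.restrict (Icc a b)
      {x | ((k + 1 : ℕ) : ℝ≥0∞) < ENNReal.ofReal (Real.log (avgSup F x / m).toReal)} ≤
        15 * ENNReal.ofReal (b - a) * 2⁻¹ ^ (k + 1) := by
    intro k
    have hsub : {x | ((k + 1 : ℕ) : ℝ≥0∞) < ENNReal.ofReal (Real.log (avgSup F x / m).toReal)} ∩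
        Icc a b ⊆ {x | 2 ^ (k + 1) * m < avgSup F₁ x} := by
      rintro x ⟨hx, hxI⟩
      have hx : ((k + 1 : ℕ) : ℝ≥0∞) < ENNReal.ofReal (Real.log (avgSup F x / m).toReal) := hx
      rw [← ENNReal.ofReal_natCast, ENNReal.ofReal_lt_ofReal_iff_of_nonneg (by positivity)] at hx
      -- This also rules out an infinite ratio, whose `toReal` is 0 and whose logarithm is then 0 by
      -- convention.
      have hpos : 0 < (avgSup F x / m).toReal := by
        by_contra! h0
        have h0' := le_antisymm h0 ENNReal.toReal_nonneg
        rw [h0', Real.log_zero] at hx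
        have : (0 : ℝ) ≤ ((k + 1 : ℕ) : ℝ) := by positivity
        linarith
      have h2 : (2 : ℝ) ^ (k + 1) < (avgSup F x / m).toReal := by
        rw [← Real.log_lt_log_iff (by positivity) hpos, Real.log_pow]
        refine lt_of_le_of_lt ?_ hx
        have := Real.log_two_lt_d9
        have : (0 : ℝ) ≤ ((k + 1 : ℕ) : ℝ) := by positivity
        nlinarith
      have h3 : 2 ^ (k + 1) * m < avgSup F x := by
        rw [← ENNReal.lt_div_iff_mul_lt (Or.inl hm0) (Or.inl hmt)]
        rw [← ENNReal.ofReal_lt_iff_lt_toReal (by positivity) (ENNReal.toReal_pos_iff.1 hpos).2.ne,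
          ENNReal.ofReal_pow (by norm_num)] at h2
        simpa using h2
      have h4 : 2 * m < avgSup F x := by
        refine lt_of_le_of_lt ?_ h3
        gcongr
        exact le_self_pow₀ (by norm_num) (by simp)
      -- The infimum need not be attained; the strict inequality supplies a point `y` with `2 *
      -- avgSup F y < avgSup F x`.
      have h5 : m < avgSup F x / 2 := by
        rw [ENNReal.lt_div_iff_mul_lt (by simp) (by simp), mul_comm]; exact h4
      rw [hm] at h5
      simp only [iInf_lt_iff] at h5
      obtain ⟨y, hy, hlt⟩ := h5
      rw [ENNReal.lt_div_iff_mul_lt (by simp) (by simp), mul_comm] at hlt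
      exact h3.trans_le (avgSup_le_of_two_mul_lt hxI hy hlt)
    rw [one_mul, Measure.restrict_apply (measurableSet_lt measurable_const hmeas)]
    refine (measure_mono hsub).trans ?_
    have hw := (mul_volume_lt_avgSup_le F₁ (2 ^ (k + 1) * m)).trans (mul_le_mul_right hF1 5)
    have hc : (2 ^ (k + 1) * m : ℝ≥0∞) ≠ 0 := by simp [hm0]
    have hc' : (2 ^ (k + 1) * m : ℝ≥0∞) ≠ ∞ := ENNReal.mul_ne_top (by simp) hmt
    rw [← ENNReal.mul_le_mul_iff_right hc hc']
    refine hw.trans (le_of_eq ?_)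
    rw [ENNReal.ofReal_mul (by norm_num)]
    have h2 : (2 : ℝ≥0∞) ^ (k + 1) * 2⁻¹ ^ (k + 1) = 1 := by
      rw [← mul_pow, ENNReal.mul_inv_cancel (by simp) (by simp), one_pow]
    calc 5 * (m * (ENNReal.ofReal 3 * ENNReal.ofReal (b - a)))
        = 15 * m * ENNReal.ofReal (b - a) * 1 := by
          rw [ENNReal.ofReal_ofNat]; ring
      _ = _ := by rw [← h2]; ring
  refine hlev.trans ((add_le_add le_rfl (ENNReal.tsum_le_tsum hterm)).trans ?_)
  rw [ENNReal.tsum_mul_left, ENNReal.tsum_geometric_add_one]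
  have : ((2 : ℝ≥0∞)⁻¹) * (1 - 2⁻¹)⁻¹ = 1 := by
    rw [ENNReal.one_sub_inv_two, inv_inv]
    exact ENNReal.inv_mul_cancel (by simp) (by simp)
  rw [this]
  simp only [Measure.restrict_apply_univ, Real.volume_Icc]
  rw [zero_add, Nat.cast_one, mul_one, ← add_mul]
  norm_num

/-! ### Self-improvement of maximal functions under an `A_∞` condition. -/

/-- The components of a bounded open subset of the line. -/
theorem IsOpen.exists_Ioo_decomposition {U : Set ℝ} (hU : IsOpen U) {p q : ℝ}
    (hpq : U ⊆ Ioo p q) :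
    ∃ S : Set (ℝ × ℝ), S.Countable ∧ S.PairwiseDisjoint (fun s => Ioo s.1 s.2) ∧
      U = ⋃ s ∈ S, Ioo s.1 s.2 ∧
      ∀ s ∈ S, s.1 < s.2 ∧ s.1 ∉ U ∧ s.2 ∉ U ∧ p ≤ s.1 ∧ s.2 ≤ q := by
  let S : Set (ℝ × ℝ) := {s | s.1 < s.2 ∧ Ioo s.1 s.2 ⊆ U ∧ s.1 ∉ U ∧ s.2 ∉ U}
  have hS : S.PairwiseDisjoint fun s => Ioo s.1 s.2 := by
    intro s hs t ht hst
    rw [Function.onFun, Set.disjoint_left]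
    intro z hzs hzt
    apply hst
    obtain ⟨hs1, hs2, hs3, hs4⟩ := hs
    obtain ⟨ht1, ht2, ht3, ht4⟩ := ht
    ext
    · rcases lt_trichotomy s.1 t.1 with h | h | h
      · exact absurd (hs2 ⟨h, hzt.1.trans hzs.2⟩) ht3
      · exact h
      · exact absurd (ht2 ⟨h, hzs.1.trans hzt.2⟩) hs3
    · rcases lt_trichotomy s.2 t.2 with h | h | h
      · exact absurd (ht2 ⟨hzt.1.trans hzs.2, h⟩) hs4
      · exact h
      · exact absurd (hs2 ⟨hzs.1.trans hzt.2, h⟩) ht4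
  refine ⟨S, hS.countable_of_isOpen (fun _ _ => isOpen_Ioo) fun s hs => nonempty_Ioo.2 hs.1,
    hS, ?_, fun s hs => ⟨hs.1, hs.2.2.1, hs.2.2.2, ?_⟩⟩
  · refine subset_antisymm (fun x hx => ?_) (iUnion₂_subset fun s hs => hs.2.1)
    have hxpq := hpq hx
    have hcl : IsClosed Uᶜ := hU.isClosed_compl
    have hA : sSup (Uᶜ ∩ Iic x) ∈ Uᶜ ∩ Iic x := (hcl.inter isClosed_Iic).csSup_mem
      ⟨p, fun h => lt_irrefl _ (hpq h).1, hxpq.1.le⟩ ⟨x, fun y hy => hy.2⟩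
    have hB : sInf (Uᶜ ∩ Ici x) ∈ Uᶜ ∩ Ici x := (hcl.inter isClosed_Ici).csInf_mem
      ⟨q, fun h => lt_irrefl _ (hpq h).2, hxpq.2.le⟩ ⟨x, fun y hy => hy.2⟩
    have hA' : sSup (Uᶜ ∩ Iic x) < x := lt_of_le_of_ne hA.2 fun h => hA.1 (by rwa [h])
    have hB' : x < sInf (Uᶜ ∩ Ici x) := lt_of_le_of_ne hB.2 fun h => hB.1 (by rwa [← h])
    -- The component of `x` extends from the last point of the complement before `x` to the first
    -- one after it.
    refine mem_biUnion (x := (sSup (Uᶜ ∩ Iic x), sInf (Uᶜ ∩ Ici x)))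
      ⟨hA'.trans hB', fun y hy => ?_, hA.1, hB.1⟩ ⟨hA', hB'⟩
    by_contra hyU
    rcases le_total y x with h | h
    · exact absurd (le_csSup (bddAbove_Iic.mono inter_subset_right)
        (show y ∈ Uᶜ ∩ Iic x from ⟨hyU, h⟩)) (not_le.2 hy.1)
    · exact absurd (csInf_le (bddBelow_Ici.mono inter_subset_right)
        (show y ∈ Uᶜ ∩ Ici x from ⟨hyU, h⟩)) (not_le.2 hy.2)
  · exact (Ioo_subset_Ioo_iff hs.1).1 (hs.2.1.trans hpq)

/-- The level sets of a maximal function inside an interval at whose end points it is small. -/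
theorem mul_volume_lt_avgSup_le_of_endpoints {F : ℝ → ℝ≥0∞} {l K : ℝ≥0∞} (hl0 : l ≠ 0)
    (hl : l ≠ ∞) (hK : 1 ≤ K) {a b : ℝ} (hab : a < b) (ha : avgSup F a ≤ l)
    (hb : avgSup F b ≤ l) :
    K * volume ({x | K * l < avgSup F x} ∩ Ioo a b) ≤ 5 * ENNReal.ofReal (b - a) := by
  have hsub : {x | K * l < avgSup F x} ∩ Ioo a b ⊆
      {x | K * l < avgSup ((Icc a b).indicator F) x} := by
    rintro x ⟨hx, hxab⟩
    obtain ⟨p, q, hpq, hxpq, hlt⟩ := lt_avgSup_iff.1 hx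
    -- An interval with mean above `l` contains no point where `avgSup F ≤ l`, so it cannot cross
    -- `a` or `b`: only `F` on `[a, b]` matters, with mean at most `l`.
    have hno : ∀ y ∈ Icc p q, ¬ avgSup F y ≤ l := fun y hy hyl => by
      refine absurd (lt_avgSup_iff.2 ⟨p, q, hpq, hy, ?_⟩) (not_lt.2 hyl)
      refine lt_of_le_of_lt ?_ hlt
      gcongr
      exact le_mul_of_one_le_left zero_le hK
    have hap : a ≤ p := by
      by_contra! h
      exact hno a ⟨h.le, hxab.1.le.trans hxpq.2⟩ ha
    have hqb : q ≤ b := by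
      by_contra! h
      exact hno b ⟨hxpq.1.trans hxab.2.le, h.le⟩ hb
    refine lt_avgSup_iff.2 ⟨p, q, hpq, hxpq, ?_⟩
    rwa [setLIntegral_indicator measurableSet_Icc,
      inter_eq_self_of_subset_right (Icc_subset_Icc hap hqb)]
  have h := mul_volume_lt_avgSup_le ((Icc a b).indicator F) (K * l)
  rw [lintegral_indicator measurableSet_Icc] at h
  have h2 : ∫⁻ t in Icc a b, F t ≤ l * ENNReal.ofReal (b - a) :=
    (lintegral_Icc_le_avgSup_mul hab ⟨le_rfl, hab.le⟩).trans (by gcongr)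
  rw [← ENNReal.mul_le_mul_iff_right hl0 hl]
  calc l * (K * volume ({x | K * l < avgSup F x} ∩ Ioo a b))
      ≤ K * l * volume {x | K * l < avgSup ((Icc a b).indicator F) x} := by
        rw [← mul_assoc, mul_comm l]
        exact mul_le_mul_right (measure_mono hsub) _
    _ ≤ 5 * (l * ENNReal.ofReal (b - a)) := h.trans (mul_le_mul_right h2 _)
    _ = _ := by ring

/-- An `A_∞` condition for a maximal function makes the mass of its level sets decay. -/
theorem two_mul_setLIntegral_level_le {F : ℝ → ℝ≥0∞} {p q δ : ℝ} (hδ : 0 < δ) {l : ℝ≥0∞}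
    (hl0 : l ≠ 0) (hl : l ≠ ∞) (hp : avgSup F p ≤ l) (hq : avgSup F q ≤ l)
    (hA : ∀ a b, p ≤ a → a < b → b ≤ q → ∀ E, MeasurableSet E → E ⊆ Ioo a b →
      volume E ≤ ENNReal.ofReal (δ * (b - a)) →
        2 * ∫⁻ x in E, avgSup F x ≤ ∫⁻ x in Ioo a b, avgSup F x) :
    2 * ∫⁻ x in {x | ENNReal.ofReal (max 2 (5 / δ)) * l < avgSup F x} ∩ Ioo p q, avgSup F x ≤
      ∫⁻ x in {x | l < avgSup F x} ∩ Ioo p q, avgSup F x := by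
  -- The value `5 / δ` turns the weak type bound `5 (b - a) / K` into `δ (b - a)` on each component;
  -- the 2 keeps the ratio of the levels above 1.
  set K := ENNReal.ofReal (max 2 (5 / δ)) with hKdef
  have hK : 1 ≤ K := by
    rw [hKdef, ← ENNReal.ofReal_one]
    exact ENNReal.ofReal_le_ofReal (le_max_of_le_left (by norm_num))
  have hKt : K ≠ ∞ := ENNReal.ofReal_ne_top
  obtain ⟨S, hSc, hSd, hSU, hS⟩ := ((isOpen_lt_avgSup F l).inter
    isOpen_Ioo).exists_Ioo_decomposition (p := p) (q := q) inter_subset_right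
  have : Countable S := hSc
  have hm : MeasurableSet {x | K * l < avgSup F x} := (isOpen_lt_avgSup F _).measurableSet
  have hend : ∀ y, p ≤ y → y ≤ q → y ∉ {x | l < avgSup F x} ∩ Ioo p q → avgSup F y ≤ l := by
    intro y hy1 hy2 hy
    rcases hy1.eq_or_lt with rfl | h1
    · exact hp
    rcases hy2.eq_or_lt with rfl | h2
    · exact hq
    by_contra! h
    exact hy ⟨h, h1, h2⟩
  have hEU : {x | K * l < avgSup F x} ∩ Ioo p q ⊆
      ⋃ s : S, {x | K * l < avgSup F x} ∩ Ioo s.1.1 s.1.2 := by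
    rintro x ⟨hx, hxpq⟩
    have hx' : x ∈ {x | l < avgSup F x} ∩ Ioo p q :=
      ⟨lt_of_le_of_lt (le_mul_of_one_le_left zero_le hK) hx, hxpq⟩
    rw [hSU] at hx'
    obtain ⟨s, hs, hxs⟩ := mem_iUnion₂.1 hx'
    exact mem_iUnion.2 ⟨⟨s, hs⟩, hx, hxs⟩
  calc 2 * ∫⁻ x in {x | K * l < avgSup F x} ∩ Ioo p q, avgSup F x
      ≤ 2 * ∑' s : S, ∫⁻ x in {x | K * l < avgSup F x} ∩ Ioo s.1.1 s.1.2, avgSup F x :=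
        mul_le_mul_right ((lintegral_mono_set hEU).trans (lintegral_iUnion_le _ _)) _
    _ = ∑' s : S, 2 * ∫⁻ x in {x | K * l < avgSup F x} ∩ Ioo s.1.1 s.1.2, avgSup F x :=
        ENNReal.tsum_mul_left.symm
    _ ≤ ∑' s : S, ∫⁻ x in Ioo s.1.1 s.1.2, avgSup F x := by
        refine ENNReal.tsum_le_tsum fun s => ?_
        obtain ⟨hs, hs1, hs2, hs3, hs4⟩ := hS s.1 s.2
        refine hA _ _ hs3 hs hs4 _ (hm.inter measurableSet_Ioo) inter_subset_right ?_
        have h := mul_volume_lt_avgSup_le_of_endpoints hl0 hl hK hs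
          (hend _ hs3 (hs.le.trans hs4) hs1) (hend _ (hs3.trans hs.le) hs4 hs2)
        have hK0 : K ≠ 0 := (zero_lt_one.trans_le hK).ne'
        rw [← ENNReal.mul_le_mul_iff_right hK0 hKt]
        refine h.trans ?_
        rw [hKdef, ← ENNReal.ofReal_ofNat, ← ENNReal.ofReal_mul (by norm_num),
          ← ENNReal.ofReal_mul (by positivity)]
        refine ENNReal.ofReal_le_ofReal ?_
        have h5 : 5 ≤ max 2 (5 / δ) * δ := by
          rw [← div_le_iff₀ hδ]; exact le_max_right _ _
        nlinarith
    _ = ∫⁻ x in ⋃ s : S, Ioo s.1.1 s.1.2, avgSup F x := by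
        rw [lintegral_iUnion (fun _ => measurableSet_Ioo)]
        exact fun s t hst => hSd s.2 t.2 (fun h => hst (Subtype.ext h))
    _ = _ := by rw [hSU, biUnion_eq_iUnion]

/-- Gehring-type self-improvement: a maximal function that satisfies an `A_∞` condition is
integrable to a power greater than one. -/
theorem exists_setLIntegral_rpow_ne_top {F : ℝ → ℝ≥0∞} {p q δ : ℝ} (hδ : 0 < δ) {l : ℝ≥0∞}
    (hl0 : l ≠ 0) (hl : l ≠ ∞) (hp : avgSup F p ≤ l) (hq : avgSup F q ≤ l)
    (hA : ∀ a b, p ≤ a → a < b → b ≤ q → ∀ E, MeasurableSet E → E ⊆ Ioo a b →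
      volume E ≤ ENNReal.ofReal (δ * (b - a)) →
        2 * ∫⁻ x in E, avgSup F x ≤ ∫⁻ x in Ioo a b, avgSup F x)
    (hint : ∫⁻ x in Ioo p q, avgSup F x ≠ ∞) :
    ∃ s : ℝ, 0 < s ∧ ∫⁻ x in Ioo p q, avgSup F x ^ (1 + s) ≠ ∞ := by
  set B : ℝ := max 2 (5 / δ) with hB
  have hB2 : 2 ≤ B := le_max_left _ _
  -- Chosen so that `B^s = 3/2`. Along the levels `B^k l` the power `ω^s` grows by `3/2` while the
  -- mass of the level set is halved, so the terms decay like `(3/4)^k`.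
  set s := Real.logb B (3 / 2) with hs
  have hspos : 0 < s := Real.logb_pos (by linarith) (by norm_num)
  have hBs : ENNReal.ofReal B ^ s = ENNReal.ofReal (3 / 2) := by
    rw [ENNReal.ofReal_rpow_of_pos (by linarith), hs,
      Real.rpow_logb (by linarith) (by linarith) (by norm_num)]
  set r := ENNReal.ofReal (3 / 2) with hr
  have hr1 : 1 < r := by rw [hr, ← ENNReal.ofReal_one, ENNReal.ofReal_lt_ofReal_iff] <;> norm_num
  have hrt : r ≠ ∞ := ENNReal.ofReal_ne_top
  refine ⟨s, hspos, ?_⟩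
  set ω := avgSup F with hω
  set I := ∫⁻ x in Ioo p q, ω x with hI
  have hωm : Measurable ω := measurable_avgSup F
  have hdecay : ∀ k : ℕ,
      ∫⁻ x in {x | ENNReal.ofReal B ^ k * l < ω x} ∩ Ioo p q, ω x ≤ 2⁻¹ ^ k * I := by
    intro k
    induction k with
    | zero => simpa using lintegral_mono_set inter_subset_right
    | succ k ih =>
      have hBk : 1 ≤ ENNReal.ofReal B ^ k := by
        refine one_le_pow₀ ?_
        rw [← ENNReal.ofReal_one]
        exact ENNReal.ofReal_le_ofReal (by linarith)
      have hlk : l ≤ ENNReal.ofReal B ^ k * l := le_mul_of_one_le_left zero_le hBk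
      have h := two_mul_setLIntegral_level_le hδ (l := ENNReal.ofReal B ^ k * l)
        (ne_of_gt (lt_of_lt_of_le (pos_iff_ne_zero.2 hl0) hlk))
        (ENNReal.mul_ne_top (by simp) hl) (hp.trans hlk) (hq.trans hlk) hA
      rw [← mul_assoc, ← hB, ← pow_succ'] at h
      have h' := h.trans ih
      rw [mul_comm, ← ENNReal.le_div_iff_mul_le (by simp) (by simp)] at h'
      refine h'.trans (le_of_eq ?_)
      rw [pow_succ, div_eq_mul_inv]; ring
  have hls : l ^ s ≠ ∞ := ENNReal.rpow_ne_top_of_nonneg hspos.le hl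
  have hls0 : l ^ s ≠ 0 := by simp [hl0, hl]
  have hset : ∀ k x, l ^ s * r ^ k < ω x ^ s ↔ ENNReal.ofReal B ^ k * l < ω x := by
    intro k x
    have : l ^ s * r ^ k = (ENNReal.ofReal B ^ k * l) ^ s := by
      rw [ENNReal.mul_rpow_of_nonneg _ _ hspos.le, ← hBs, mul_comm, ← ENNReal.rpow_natCast,
        ← ENNReal.rpow_natCast, ← ENNReal.rpow_mul, ← ENNReal.rpow_mul, mul_comm s]
    rw [this, ENNReal.rpow_lt_rpow_iff hspos]
  -- Layer cake for `ω^s` against `ω dx`, which computes `∫ ω^(1+s)`. The increments are half the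
  -- levels, since `3/2 - 1 = 1/2`.
  have hlev := lintegral_le_tsum_levels ((volume.restrict (Ioo p q)).withDensity ω)
    (a := fun k => l ^ s * r ^ k) (d := fun k => l ^ s * r ^ k * 2⁻¹)
    (fun k => by
      have : r = 1 + 2⁻¹ := by
        rw [hr, show (3 / 2 : ℝ) = 1 + 2⁻¹ by norm_num, ENNReal.ofReal_add (by norm_num)
          (by norm_num), ENNReal.ofReal_inv_of_pos (by norm_num)]
        simp
      calc l ^ s * r ^ (k + 1) = l ^ s * r ^ k * r := by rw [pow_succ, mul_assoc]
        _ = _ := by rw [this]; ring)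
    (fun R hR => exists_lt_const_mul_pow hls0 hr1 hR)
    (hωm.pow_const s)
  rw [lintegral_withDensity_eq_lintegral_mul _ hωm (hωm.pow_const s)] at hlev
  have heq : ∫⁻ x in Ioo p q, ω x ^ (1 + s) = ∫⁻ x in Ioo p q, (ω * fun x => ω x ^ s) x := by
    refine lintegral_congr fun x => ?_
    rw [Pi.mul_apply, ENNReal.rpow_add_of_nonneg _ _ zero_le_one hspos.le, ENNReal.rpow_one]
  rw [heq]
  have hterm : ∀ k : ℕ, l ^ s * r ^ k * 2⁻¹ * ((volume.restrict (Ioo p q)).withDensity ω)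
      {x | l ^ s * r ^ k < ω x ^ s} ≤ l ^ s * 2⁻¹ * I * ENNReal.ofReal (3 / 4) ^ k := by
    intro k
    have hmeas : MeasurableSet {x | ENNReal.ofReal B ^ k * l < ω x} :=
      (isOpen_lt_avgSup F _).measurableSet
    simp only [hset]
    rw [withDensity_apply _ hmeas, Measure.restrict_restrict hmeas]
    refine (mul_le_mul_right (hdecay k) _).trans (le_of_eq ?_)
    have : ENNReal.ofReal (3 / 4) = r * 2⁻¹ := by
      rw [hr, show (3 / 4 : ℝ) = 3 / 2 * 2⁻¹ by norm_num, ENNReal.ofReal_mul (by norm_num),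
        ENNReal.ofReal_inv_of_pos (by norm_num)]
      simp
    rw [this, mul_pow]; ring
  refine ne_top_of_le_ne_top ?_ (hlev.trans (add_le_add le_rfl (ENNReal.tsum_le_tsum hterm)))
  rw [withDensity_apply _ MeasurableSet.univ, Measure.restrict_univ, ENNReal.tsum_mul_left,
    ENNReal.tsum_geometric]
  refine ENNReal.add_ne_top.2 ⟨ENNReal.mul_ne_top (by simpa using hls) hint,
    ENNReal.mul_ne_top (ENNReal.mul_ne_top (ENNReal.mul_ne_top hls (by simp)) hint) ?_⟩
  rw [ENNReal.inv_ne_top, Ne, tsub_eq_zero_iff_le, not_le, ← ENNReal.ofReal_one,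
    ENNReal.ofReal_lt_ofReal_iff] <;> norm_num

end maximal

/-! ### Riesz products: exact means and unbounded `L^q` norms. -/

section riesz
open Set Filter Topology
open scoped ENNReal Real

/-- Translations by `2π/3` preserve `φ` and the integral over a period, so `c` may be replaced by
its average over three translates, which is the constant `a`. -/
theorem integral_mul_of_trisection {c φ : ℝ → ℝ} {a : ℝ} (hc : Continuous c)
    (hcp : Function.Periodic c (2 * π)) (hφ : Continuous φ)
    (hφp : Function.Periodic φ (2 * π / 3))
    (h3 : ∀ t, c t + c (t + 2 * π / 3) + c (t + 2 * (2 * π / 3)) = 3 * a) :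
    ∫ t in (0 : ℝ)..2 * π, c t * φ t = a * ∫ t in (0 : ℝ)..2 * π, φ t := by
  set ψ : ℝ → ℝ := fun t => c t * φ t with hψ
  have hφ2 : Function.Periodic φ (2 * π) := by
    have := hφp.nat_mul 3
    rwa [show ((3 : ℕ) : ℝ) * (2 * π / 3) = 2 * π by push_cast; ring] at this
  have hψp : Function.Periodic ψ (2 * π) := fun t => by simp only [hψ, hcp t, hφ2 t]
  have hψc : Continuous ψ := hc.mul hφ
  have hshift : ∀ s : ℝ, ∫ t in (0 : ℝ)..2 * π, ψ (t + s) = ∫ t in (0 : ℝ)..2 * π, ψ t := by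
    intro s
    rw [intervalIntegral.integral_comp_add_right, zero_add, add_comm,
      hψp.intervalIntegral_add_eq s 0, zero_add]
  have hsum : ∫ t in (0 : ℝ)..2 * π, (ψ t + ψ (t + 2 * π / 3) + ψ (t + 2 * (2 * π / 3))) =
      3 * ∫ t in (0 : ℝ)..2 * π, ψ t := by
    rw [intervalIntegral.integral_add, intervalIntegral.integral_add, hshift, hshift]
    · ring
    all_goals exact Continuous.intervalIntegrable (by fun_prop) _ _
  have hpt : ∀ t, ψ t + ψ (t + 2 * π / 3) + ψ (t + 2 * (2 * π / 3)) = 3 * a * φ t := by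
    intro t
    have h2 := hφp.nat_mul 2 t
    push_cast at h2
    simp only [hψ]
    rw [hφp t, h2, ← h3 t]; ring
  simp only [hpt, intervalIntegral.integral_const_mul] at hsum
  linarith

theorem integral_comp_three_mul {G : ℝ → ℝ} (hG : Continuous G) (hp : Function.Periodic G (2 * π)) :
    ∫ t in (0 : ℝ)..2 * π, G (3 * t) = ∫ t in (0 : ℝ)..2 * π, G t := by
  rw [intervalIntegral.integral_comp_mul_left _ (by norm_num), mul_zero]
  have h := hp.intervalIntegral_add_zsmul_eq 3 0
  simp only [zero_add, zsmul_eq_mul] at h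
  push_cast at h
  rw [h fun _ _ => hG.intervalIntegrable _ _, smul_eq_mul]; ring

/-- The mean of a lacunary product with ratio three is the product of the means. -/
theorem integral_prod_pow_three {c : ℝ → ℝ} {a : ℝ} (hc : Continuous c)
    (hcp : Function.Periodic c (2 * π))
    (h3 : ∀ t, c t + c (t + 2 * π / 3) + c (t + 2 * (2 * π / 3)) = 3 * a) (m : ℕ) :
    ∫ t in (0 : ℝ)..2 * π, ∏ j ∈ Finset.range m, c (3 ^ j * t) = 2 * π * a ^ m := by
  induction m with
  | zero => simp
  | succ m ih =>
    set G : ℝ → ℝ := fun t => ∏ j ∈ Finset.range m, c (3 ^ j * t) with hG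
    have hGc : Continuous G := continuous_finsetProd _ fun j _ => by fun_prop
    have hGp : Function.Periodic G (2 * π) := fun t => by
      refine Finset.prod_congr rfl fun j _ => ?_
      have := hcp.nat_mul (3 ^ j) (3 ^ j * t)
      rw [← this]; push_cast; ring_nf
    -- Splitting off the factor `j = 0` leaves a function of `3t`, of period `2π/3`, to which
    -- trisection applies.
    have hpt : ∀ t, ∏ j ∈ Finset.range (m + 1), c (3 ^ j * t) = c t * G (3 * t) := by
      intro t
      rw [Finset.prod_range_succ', mul_comm]
      simp only [pow_zero, one_mul, hG]
      congr 1
      refine Finset.prod_congr rfl fun j _ => ?_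
      rw [pow_succ, mul_assoc]
    simp only [hpt]
    rw [integral_mul_of_trisection hc hcp (φ := fun t => G (3 * t)) (by fun_prop) ?_ h3,
      integral_comp_three_mul hGc hGp, ih]
    · ring
    · intro t
      simp only
      rw [← hGp (3 * t)]; ring_nf

theorem cos_trisection (t : ℝ) :
    Real.cos t + Real.cos (t + 2 * π / 3) + Real.cos (t + 2 * (2 * π / 3)) = 0 := by
  have h1 : Real.cos (2 * π / 3) = -1 / 2 := by
    rw [show 2 * π / 3 = π - π / 3 by ring, Real.cos_pi_sub, Real.cos_pi_div_three]; ring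
  have h2 : Real.cos (2 * (2 * π / 3)) = -1 / 2 := by rw [Real.cos_two_mul, h1]; norm_num
  have h3 : Real.sin (2 * (2 * π / 3)) = - Real.sin (2 * π / 3) := by
    rw [Real.sin_two_mul, h1]; ring
  rw [Real.cos_add, Real.cos_add, h1, h2, h3]; ring

theorem cos_sq_trisection (t : ℝ) :
    Real.cos t ^ 2 + Real.cos (t + 2 * π / 3) ^ 2 + Real.cos (t + 2 * (2 * π / 3)) ^ 2 =
      3 / 2 := by
  -- Doubling the angle permutes the three shifts modulo `2π`.
  have h := cos_trisection (2 * t)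
  have e1 : Real.cos (2 * t + 2 * π / 3) = Real.cos (2 * (t + 2 * (2 * π / 3))) := by
    rw [← Real.cos_add_two_pi (2 * t + 2 * π / 3)]; ring_nf
  have e2 : Real.cos (2 * t + 2 * (2 * π / 3)) = Real.cos (2 * (t + 2 * π / 3)) := by ring_nf
  rw [e1, e2, Real.cos_two_mul, Real.cos_two_mul, Real.cos_two_mul] at h
  linarith

theorem continuous_rieszProd (ε : ℝ) (n : ℕ) : Continuous (rieszProd ε n) :=
  continuous_finsetProd _ fun j _ => by fun_prop

theorem rieszProd_periodic (ε : ℝ) (n : ℕ) : Function.Periodic (rieszProd ε n) (2 * π) := by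
  intro t
  refine Finset.prod_congr rfl fun j _ => ?_
  rw [← Real.cos_add_nat_mul_two_pi (3 ^ j * t) (3 ^ j)]
  push_cast; ring_nf

theorem one_sub_le_one_add_mul_cos {ε : ℝ} (hε0 : 0 < ε) (u : ℝ) :
    1 - ε ≤ 1 + ε * Real.cos u := by
  nlinarith [Real.neg_one_le_cos u]

theorem rieszProd_pos {ε : ℝ} (hε0 : 0 < ε) (hε1 : ε < 1) (n : ℕ) (t : ℝ) :
    0 < rieszProd ε n t :=
  Finset.prod_pos fun j _ => by linarith [one_sub_le_one_add_mul_cos hε0 (3 ^ j * t)]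

theorem integral_rieszProd (ε : ℝ) (n : ℕ) :
    ∫ t in (0 : ℝ)..2 * π, rieszProd ε n t = 2 * π := by
  have h := integral_prod_pow_three (c := fun t => 1 + ε * Real.cos t) (a := 1) (by fun_prop)
    (fun t => by simp) (fun t => by linear_combination ε * cos_trisection t) (n + 1)
  simpa [rieszProd] using h

/-- A majorant of the square root of a Riesz product with exponentially small mean. -/
theorem exists_sqrt_majorant {ε : ℝ} (hε0 : 0 < ε) (hε1 : ε < 1) (n : ℕ) :
    ∃ Q : ℝ → ℝ, Continuous Q ∧ (∀ t, 0 < Q t) ∧ (∀ t, rieszProd ε n t ≤ Q t ^ 2) ∧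
      ∫ t in (0 : ℝ)..2 * π, Q t = 2 * π * (1 - ε ^ 2 / 24) ^ (n + 1) := by
  -- With `x = ε cos u`, `(1 + x/2 - x²/12)² = 1 + x + x²(1 - x)/12 + x⁴/144 ≥ 1 + x`. Unlike the
  -- square root, this quadratic in the cosine has constant three-point averages; its mean is `1 -
  -- ε²/24 < 1`.
  set c : ℝ → ℝ := fun t => 1 + ε * Real.cos t / 2 - ε ^ 2 * Real.cos t ^ 2 / 12 with hc
  have habs : ∀ u, -1 < ε * Real.cos u ∧ ε * Real.cos u < 1 := fun u => by
    constructor <;> nlinarith [Real.neg_one_le_cos u, Real.cos_le_one u]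
  have hpos : ∀ u, 0 < c u := fun u => by
    have ⟨h1, h2⟩ := habs u
    simp only [hc]
    rw [← mul_pow]
    nlinarith
  have hsq : ∀ u, 1 + ε * Real.cos u ≤ c u ^ 2 := fun u => by
    have ⟨h1, h2⟩ := habs u
    simp only [hc]
    rw [← mul_pow]
    set x := ε * Real.cos u
    nlinarith [mul_nonneg (sq_nonneg x) (sub_nonneg.2 h2.le), sq_nonneg (x ^ 2)]
  refine ⟨fun t => ∏ j ∈ Finset.range (n + 1), c (3 ^ j * t),
    continuous_finsetProd _ fun j _ => by fun_prop,
    fun t => Finset.prod_pos fun j _ => hpos _, fun t => ?_, ?_⟩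
  · rw [← Finset.prod_pow]
    refine Finset.prod_le_prod (fun j _ => ?_) fun j _ => hsq _
    linarith [one_sub_le_one_add_mul_cos hε0 (3 ^ j * t)]
  · refine integral_prod_pow_three (by fun_prop) (fun t => by simp [hc]) (fun t => ?_) _
    simp only [hc]
    linear_combination ε / 2 * cos_trisection t - ε ^ 2 / 12 * cos_sq_trisection t

/-- Where `P ≤ T²`, `P ≤ T √P ≤ T Q`, and `T ∫ Q` is at most `π` for large `n`. So at least half of
the mass `2π` lies where `P > T²`, and there `P ≤ P^q / T^(2(q-1))`. -/
theorem exists_le_integral_rieszProd_rpow {ε : ℝ} (hε0 : 0 < ε) (hε1 : ε < 1) {q : ℝ}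
    (hq : 1 < q) (R : ℝ) :
    ∃ n, R ≤ ∫ t in (0 : ℝ)..2 * π, rieszProd ε n t ^ q := by
  obtain ⟨T, hT1, hTR⟩ : ∃ T : ℝ, 0 < T ∧ R ≤ π * (T ^ 2) ^ (q - 1) := by
    have h : Tendsto (fun T : ℝ => π * (T ^ 2) ^ (q - 1)) atTop atTop :=
      ((tendsto_rpow_atTop (by linarith)).comp (tendsto_pow_atTop (by norm_num))).const_mul_atTop
        Real.pi_pos
    obtain ⟨T, h1, h2⟩ := ((h.eventually_ge_atTop R).and (eventually_gt_atTop 0)).exists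
    exact ⟨T, h2, h1⟩
  obtain ⟨n, hn⟩ : ∃ n : ℕ, (1 - ε ^ 2 / 24) ^ n < 1 / (2 * T) :=
    exists_pow_lt_of_lt_one (by positivity) (by nlinarith)
  refine ⟨n, hTR.trans ?_⟩
  obtain ⟨Q, hQc, hQ0, hPQ, hQI⟩ := exists_sqrt_majorant hε0 hε1 n
  have hPc := continuous_rieszProd ε n
  have hP0 := rieszProd_pos hε0 hε1 n
  have hTp : 0 < (T ^ 2) ^ (q - 1) := by positivity
  have hpt : ∀ t, rieszProd ε n t ≤ T * Q t + ((T ^ 2) ^ (q - 1))⁻¹ * rieszProd ε n t ^ q := by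
    intro t
    have hP := hP0 t
    rcases le_total (rieszProd ε n t) (T ^ 2) with h | h
    · have h1 : rieszProd ε n t ≤ T * Q t := by
        refine le_of_sq_le_sq ?_ (mul_pos hT1 (hQ0 t)).le
        rw [mul_pow, sq (rieszProd ε n t)]
        exact mul_le_mul h (hPQ t) hP.le (by positivity)
      have : 0 ≤ ((T ^ 2) ^ (q - 1))⁻¹ * rieszProd ε n t ^ q := by positivity
      linarith
    · have h1 : rieszProd ε n t ≤ ((T ^ 2) ^ (q - 1))⁻¹ * rieszProd ε n t ^ q := by
        rw [inv_mul_eq_div, le_div_iff₀ hTp]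
        have : rieszProd ε n t ^ q = rieszProd ε n t * rieszProd ε n t ^ (q - 1) := by
          rw [← Real.rpow_one_add' hP.le (by linarith)]; ring_nf
        rw [this]
        gcongr
      have : 0 ≤ T * Q t := (mul_pos hT1 (hQ0 t)).le
      linarith
  have hPq : Continuous fun t => rieszProd ε n t ^ q :=
    hPc.rpow_const fun t => Or.inl (hP0 t).ne'
  have hint := intervalIntegral.integral_mono_on (μ := volume) (a := 0) (b := 2 * π) (by positivity)
    (hPc.intervalIntegrable _ _)
    (Continuous.intervalIntegrable (by fun_prop) _ _) (fun t _ => hpt t)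
  rw [integral_rieszProd, intervalIntegral.integral_add (Continuous.intervalIntegrable (by fun_prop) _ _)
    (Continuous.intervalIntegrable (by fun_prop) _ _), intervalIntegral.integral_const_mul,
    intervalIntegral.integral_const_mul,
    hQI] at hint
  have h2 : T * (2 * π * (1 - ε ^ 2 / 24) ^ (n + 1)) ≤ π := by
    have h3 : (1 - ε ^ 2 / 24) ^ (n + 1) ≤ (1 - ε ^ 2 / 24) ^ n :=
      pow_le_pow_of_le_one (by nlinarith) (by nlinarith) (Nat.le_succ n)
    have h4 : T * (1 / (2 * T)) = 1 / 2 := by field_simp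
    have h5 : T * (1 - ε ^ 2 / 24) ^ (n + 1) ≤ 1 / 2 := by
      rw [← h4]; gcongr; linarith
    nlinarith [Real.pi_pos]
  have h6 : π ≤ ((T ^ 2) ^ (q - 1))⁻¹ * ∫ t in (0 : ℝ)..2 * π, rieszProd ε n t ^ q := by linarith
  rwa [inv_mul_eq_div, le_div_iff₀ hTp] at h6

theorem integral_periodMeasure (f : ℝ → ℝ) :
    ∫ x, f x ∂periodMeasure = ∫ x in (0 : ℝ)..2 * π, f x := by
  rw [periodMeasure, intervalIntegral.integral_of_le (by positivity), integral_Ico_eq_integral_Ioo,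
    integral_Ioc_eq_integral_Ioo]

instance isFiniteMeasure_periodMeasure : IsFiniteMeasure periodMeasure :=
  ⟨by simp [periodMeasure, ENNReal.mul_lt_top]⟩

theorem Continuous.integrable_periodMeasure {f : ℝ → ℝ} (hf : Continuous f) :
    Integrable f periodMeasure :=
  (hf.integrableOn_Icc (a := 0) (b := 2 * π)).mono_set Ico_subset_Icc_self

theorem eLpNorm_rieszProd {ε : ℝ} (hε0 : 0 < ε) (hε1 : ε < 1) (n : ℕ) {q : ℝ} (hq : 0 < q) :
    eLpNorm (rieszProd ε n) (ENNReal.ofReal q) periodMeasure =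
      ENNReal.ofReal ((∫ t in (0 : ℝ)..2 * π, rieszProd ε n t ^ q) ^ (1 / q)) := by
  have hcq : Continuous fun t => rieszProd ε n t ^ q :=
    (continuous_rieszProd ε n).rpow_const fun t => Or.inl (rieszProd_pos hε0 hε1 n t).ne'
  have hn : ∀ t, ‖rieszProd ε n t‖ ^ q = rieszProd ε n t ^ q := fun t => by
    rw [Real.norm_of_nonneg (rieszProd_pos hε0 hε1 n t).le]
  have hne : ENNReal.ofReal q ≠ 0 := by simpa using hq
  have hmem : MemLp (rieszProd ε n) (ENNReal.ofReal q) periodMeasure := by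
    rw [← integrable_norm_rpow_iff (continuous_rieszProd ε n).aestronglyMeasurable hne
      ENNReal.ofReal_ne_top, ENNReal.toReal_ofReal hq.le]
    simp only [hn]
    exact hcq.integrable_periodMeasure
  rw [hmem.eLpNorm_eq_integral_rpow_norm hne ENNReal.ofReal_ne_top, ENNReal.toReal_ofReal hq.le]
  simp only [hn]
  rw [integral_periodMeasure, one_div]

theorem exists_fastGrowth {ε : ℝ} (hε0 : 0 < ε) (hε1 : ε < 1) : ∃ N, FastGrowth ε N := by
  have h : ∀ n : ℕ, ∃ N : ℕ, 1 ≤ n → (4 : ℝ≥0∞) ^ n ≤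
      eLpNorm (rieszProd ε N) (ENNReal.ofReal (1 + 1 / (n : ℝ))) periodMeasure := by
    intro n
    by_cases hn : 1 ≤ n
    · have hn' : (0 : ℝ) < n := by exact_mod_cast hn
      have hq : 1 < 1 + 1 / (n : ℝ) := by
        have : 0 < 1 / (n : ℝ) := by positivity
        linarith
      obtain ⟨N, hN⟩ := exists_le_integral_rieszProd_rpow hε0 hε1 hq (((4 : ℝ) ^ n) ^ (1 + 1 / (n : ℝ)))
      refine ⟨N, fun _ => ?_⟩
      rw [eLpNorm_rieszProd hε0 hε1 N (by linarith)]
      rw [show (4 : ℝ≥0∞) ^ n = ENNReal.ofReal ((4 : ℝ) ^ n) by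
        rw [ENNReal.ofReal_pow (by norm_num)]; simp]
      refine ENNReal.ofReal_le_ofReal ?_
      rw [one_div (1 + 1 / (n : ℝ))]
      exact (Real.le_rpow_inv_iff_of_pos (by positivity)
        ((by positivity : (0 : ℝ) ≤ _).trans hN) (by linarith)).2 hN
    · exact ⟨0, fun h => absurd h hn⟩
  choose N hN using h
  exact ⟨N, fun n hn => hN n hn⟩

/-! ### Triadic quasi-invariance, and convergence of the sum in `L log L`. -/

/-- Riesz products are quasi-invariant under triadic translations, uniformly in the scale. -/
theorem rieszProd_add_le {ε : ℝ} (hε0 : 0 < ε) (hε1 : ε < 1) (n k : ℕ) {τ : ℝ}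
    (hτ : |τ| = 2 * π / 3 ^ k) (t : ℝ) :
    rieszProd ε n (t + τ) ≤ Real.exp (ε / (1 - ε) * π) * rieszProd ε n t := by
  have h1ε : 0 < 1 - ε := by linarith
  have hκ : 0 ≤ ε / (1 - ε) := by positivity
  -- For `j < k` the factor moves by at most `ε 3^j |τ|` and is at least `1 - ε`; for `j ≥ k`, `3^j
  -- τ` is a multiple of `2π`. As `∑_{j<k} 3^j ≤ 3^k / 2`, the exponents add up to at most `π ε / (1
  -- - ε)`.
  set e : ℕ → ℝ := fun j => if j < k then ε / (1 - ε) * (3 ^ j * (2 * π / 3 ^ k)) else 0 with he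
  have hfac : ∀ j, 1 + ε * Real.cos (3 ^ j * (t + τ)) ≤
      Real.exp (e j) * (1 + ε * Real.cos (3 ^ j * t)) := by
    intro j
    by_cases hj : j < k
    · simp only [he, if_pos hj]
      have hlip : |Real.cos (3 ^ j * (t + τ)) - Real.cos (3 ^ j * t)| ≤
          3 ^ j * (2 * π / 3 ^ k) := by
        have := Real.abs_cos_sub_cos_le (3 ^ j * (t + τ)) (3 ^ j * t)
        rwa [show 3 ^ j * (t + τ) - 3 ^ j * t = 3 ^ j * τ by ring, abs_mul, hτ,
          abs_of_pos (by positivity : (0 : ℝ) < 3 ^ j)] at this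
      have h1 := (abs_le.1 hlip).2
      set v : ℝ := 3 ^ j * (2 * π / 3 ^ k)
      set x := 1 + ε * Real.cos (3 ^ j * t)
      have hv : 0 ≤ v := by positivity
      have hx : 1 - ε ≤ x := one_sub_le_one_add_mul_cos hε0 _
      have h2 : ε * v ≤ ε / (1 - ε) * v * x := by
        rw [div_mul_eq_mul_div, div_mul_eq_mul_div, le_div_iff₀ h1ε]
        exact mul_le_mul_of_nonneg_left hx (by positivity)
      calc 1 + ε * Real.cos (3 ^ j * (t + τ)) ≤ x + ε * v := by
            simp only [x]; nlinarith
        _ ≤ (ε / (1 - ε) * v + 1) * x := by linarith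
        _ ≤ _ := mul_le_mul_of_nonneg_right (Real.add_one_le_exp _) (by linarith)
    · simp only [he, if_neg hj, Real.exp_zero, one_mul]
      push Not at hj
      refine le_of_eq ?_
      congr 2
      have h3 : (3 : ℝ) ^ j * (2 * π / 3 ^ k) = (3 ^ (j - k) : ℕ) * (2 * π) := by
        push_cast
        rw [pow_sub₀ _ (by norm_num) hj]; field_simp
      rcases abs_choice τ with h | h
      · rw [h] at hτ
        rw [mul_add, hτ, h3, Real.cos_add_nat_mul_two_pi]
      · have hτ' : τ = -(2 * π / 3 ^ k) := by linarith
        rw [mul_add, hτ', mul_neg, h3, ← sub_eq_add_neg, Real.cos_sub_nat_mul_two_pi]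
  have hgeom : ∀ k : ℕ, ∑ j ∈ Finset.range k, (3 : ℝ) ^ j ≤ 3 ^ k / 2 := by
    intro k
    induction k with
    | zero => norm_num
    | succ k ih => rw [Finset.sum_range_succ, pow_succ]; linarith
  have hsum : ∑ j ∈ Finset.range (n + 1), e j ≤ ε / (1 - ε) * π := by
    calc ∑ j ∈ Finset.range (n + 1), e j
        = ∑ j ∈ (Finset.range (n + 1)).filter (· < k),
            ε / (1 - ε) * (3 ^ j * (2 * π / 3 ^ k)) := by rw [Finset.sum_filter]
      _ ≤ ∑ j ∈ Finset.range k, ε / (1 - ε) * (3 ^ j * (2 * π / 3 ^ k)) := by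
          refine Finset.sum_le_sum_of_subset_of_nonneg (fun j hj => ?_) fun j _ _ => by positivity
          exact Finset.mem_range.2 (Finset.mem_filter.1 hj).2
      _ = ε / (1 - ε) * ((∑ j ∈ Finset.range k, (3 : ℝ) ^ j) * (2 * π / 3 ^ k)) := by
          rw [Finset.sum_mul, Finset.mul_sum]
      _ ≤ ε / (1 - ε) * (3 ^ k / 2 * (2 * π / 3 ^ k)) := by
          gcongr; exact hgeom k
      _ = ε / (1 - ε) * π := by
          congr 1; field_simp
  calc rieszProd ε n (t + τ) ≤ ∏ j ∈ Finset.range (n + 1),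
        (Real.exp (e j) * (1 + ε * Real.cos (3 ^ j * t))) := by
        refine Finset.prod_le_prod (fun j _ => ?_) fun j _ => hfac j
        linarith [one_sub_le_one_add_mul_cos hε0 (3 ^ j * (t + τ))]
    _ = Real.exp (∑ j ∈ Finset.range (n + 1), e j) * rieszProd ε n t := by
        rw [Finset.prod_mul_distrib, Real.exp_sum, rieszProd]
    _ ≤ _ := mul_le_mul_of_nonneg_right (Real.exp_le_exp.2 hsum)
        (rieszProd_pos hε0 hε1 n t).le

theorem one_le_log_exp_one_add {v : ℝ} (hv : 0 ≤ v) : 1 ≤ Real.log (Real.exp 1 + v) := by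
  rw [Real.le_log_iff_exp_le (by positivity)]; linarith

theorem abs_le_llogl (g : ℝ → ℝ) (x : ℝ) : |g x| ≤ llogl g x :=
  le_mul_of_one_le_right (abs_nonneg _) (one_le_log_exp_one_add (abs_nonneg _))

theorem llogl_nonneg (g : ℝ → ℝ) (x : ℝ) : 0 ≤ llogl g x := (abs_nonneg _).trans (abs_le_llogl g x)

theorem continuous_llogl {g : ℝ → ℝ} (hg : Continuous g) : Continuous (llogl g) := by
  unfold llogl
  refine hg.abs.mul (Continuous.log (by fun_prop) fun x => ?_)
  positivity

theorem two_pi_le_llogLNorm_rieszProd (ε : ℝ) (n : ℕ) :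
    2 * π ≤ llogLNorm (rieszProd ε n) := by
  have h : ∫ x, rieszProd ε n x ∂periodMeasure ≤ llogLNorm (rieszProd ε n) := by
    refine integral_mono (continuous_rieszProd ε n).integrable_periodMeasure
      (continuous_llogl (continuous_rieszProd ε n)).integrable_periodMeasure fun x => ?_
    exact (le_abs_self _).trans (abs_le_llogl _ x)
  rwa [integral_periodMeasure, integral_rieszProd] at h

theorem one_le_llogLNorm_rieszProd (ε : ℝ) (n : ℕ) :
    1 ≤ llogLNorm (rieszProd ε n) := by
  linarith [two_pi_le_llogLNorm_rieszProd ε n, Real.pi_gt_three]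

theorem rieszTerm_pos {ε : ℝ} (hε0 : 0 < ε) (hε1 : ε < 1) (N : ℕ → ℕ) (n : ℕ) (x : ℝ) :
    0 < rieszTerm ε N n x := by
  have := one_le_llogLNorm_rieszProd ε (N n)
  have := rieszProd_pos hε0 hε1 (N n) x
  unfold rieszTerm
  positivity

theorem continuous_rieszTerm (ε : ℝ) (N : ℕ → ℕ) (n : ℕ) : Continuous (rieszTerm ε N n) := by
  have := continuous_rieszProd ε (N n)
  unfold rieszTerm
  fun_prop

theorem rieszTerm_periodic (ε : ℝ) (N : ℕ → ℕ) (n : ℕ) :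
    Function.Periodic (rieszTerm ε N n) (2 * π) := fun x => by
  simp only [rieszTerm, rieszProd_periodic ε (N n) x]

theorem rieszSum_periodic (ε : ℝ) (N : ℕ → ℕ) : Function.Periodic (rieszSum ε N) (2 * π) :=
  fun x => tsum_congr fun n => rieszTerm_periodic ε N (n + 1) x

theorem rieszSum_nonneg {ε : ℝ} (hε0 : 0 < ε) (hε1 : ε < 1) (N : ℕ → ℕ) (x : ℝ) :
    0 ≤ rieszSum ε N x := tsum_nonneg fun n => (rieszTerm_pos hε0 hε1 N (n + 1) x).le

theorem measurable_rieszSum {ε : ℝ} (hε0 : 0 < ε) (hε1 : ε < 1) (N : ℕ → ℕ) :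
    Measurable (rieszSum ε N) := by
  -- The conventions agree where the series diverges: the real sum is 0, and so is `toReal` of `∞`.
  have h : rieszSum ε N =
      fun x => (∑' n : ℕ, ENNReal.ofReal (rieszTerm ε N (n + 1) x)).toReal := by
    ext x
    rw [ENNReal.tsum_toReal_eq fun n => ENNReal.ofReal_ne_top]
    exact tsum_congr fun n => (ENNReal.toReal_ofReal (rieszTerm_pos hε0 hε1 N (n + 1) x).le).symm
  rw [h]
  exact (Measurable.tsum fun n =>
    (continuous_rieszTerm ε N (n + 1)).measurable.ennreal_ofReal).ennreal_toReal

/-- The tangent line inequality for `u log (e + u)`. -/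
theorem mul_log_tangent_le {u v : ℝ} (hu : 0 ≤ u) (hv : 0 ≤ v) :
    u * Real.log (Real.exp 1 + u) +
        (Real.log (Real.exp 1 + u) + u / (Real.exp 1 + u)) * (v - u) ≤
      v * Real.log (Real.exp 1 + v) := by
  have he := Real.exp_pos 1
  set e := Real.exp 1
  have hu' : 0 < e + u := by linarith
  have hv' : 0 < e + v := by linarith
  have h1 : (v - u) / (e + v) ≤ Real.log (e + v) - Real.log (e + u) := by
    have := Real.log_le_sub_one_of_pos (div_pos hu' hv')
    rw [Real.log_div hu'.ne' hv'.ne'] at this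
    have h2 : (v - u) / (e + v) = 1 - (e + u) / (e + v) := by field_simp; ring
    linarith
  have h3 : u / (e + u) * (v - u) ≤ v * ((v - u) / (e + v)) := by
    have h4 : v * ((v - u) / (e + v)) - u / (e + u) * (v - u) =
        e * (v - u) ^ 2 / ((e + v) * (e + u)) := by field_simp; ring
    have : 0 ≤ e * (v - u) ^ 2 / ((e + v) * (e + u)) := by positivity
    linarith
  have h5 := mul_le_mul_of_nonneg_left h1 hv
  nlinarith

/-- Jensen's inequality for `u log (e + u)` and countably many weights. -/
theorem mul_log_tsum_le {w v : ℕ → ℝ} (hw : ∀ n, 0 ≤ w n) (hw1 : HasSum w 1)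
    (hv : ∀ n, 0 ≤ v n) (hs : Summable fun n => w n * v n)
    (hs' : Summable fun n => w n * (v n * Real.log (Real.exp 1 + v n))) :
    (∑' n, w n * v n) * Real.log (Real.exp 1 + ∑' n, w n * v n) ≤
      ∑' n, w n * (v n * Real.log (Real.exp 1 + v n)) := by
  set u := ∑' n, w n * v n with hu
  have hu0 : 0 ≤ u := tsum_nonneg fun n => mul_nonneg (hw n) (hv n)
  set A := u * Real.log (Real.exp 1 + u)
  set D := Real.log (Real.exp 1 + u) + u / (Real.exp 1 + u)
  -- The tangent lines are taken at the mean `u`; since the weights have sum one, their linear parts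
  -- cancel.
  have hlhs : HasSum (fun n => w n * A + (D * (w n * v n) - D * u * w n)) (1 * A + (D * u - D * u * 1)) :=
    (hw1.mul_right A).add ((hs.hasSum.mul_left D).sub (hw1.mul_left _))
  have := hasSum_le (fun n => ?_) hlhs hs'.hasSum
  · linarith
  · have h := mul_le_mul_of_nonneg_left (mul_log_tangent_le hu0 (hv n)) (hw n)
    refine le_trans (le_of_eq ?_) h
    ring

theorem hasSum_two_inv_pow_succ : HasSum (fun n : ℕ => (2 : ℝ)⁻¹ ^ (n + 1)) 1 := by
  have h := (hasSum_geometric_of_lt_one (r := (2 : ℝ)⁻¹) (by norm_num) (by norm_num)).mul_left 2⁻¹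
  norm_num at h
  simpa [pow_succ'] using h

/-- The majorant of `llogl` of the sum of normalized Riesz products given by convexity. -/
noncomputable def rieszMajorant (ε : ℝ) (N : ℕ → ℕ) (n : ℕ) (x : ℝ) : ℝ :=
  (2 : ℝ)⁻¹ ^ n * (llogl (rieszProd ε (N n)) x / llogLNorm (rieszProd ε (N n)))

theorem mul_log_normalized_le {ε : ℝ} (hε0 : 0 < ε) (hε1 : ε < 1) (n : ℕ) (x : ℝ) :
    rieszProd ε n x / llogLNorm (rieszProd ε n) *
        Real.log (Real.exp 1 + rieszProd ε n x / llogLNorm (rieszProd ε n)) ≤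
      llogl (rieszProd ε n) x / llogLNorm (rieszProd ε n) := by
  have hL := one_le_llogLNorm_rieszProd ε n
  have hP := rieszProd_pos hε0 hε1 n x
  rw [llogl, abs_of_pos hP, mul_div_right_comm]
  gcongr
  exact div_le_self hP.le hL

theorem rieszTerm_le_rieszMajorant (ε : ℝ) (N : ℕ → ℕ) (n : ℕ)
    (x : ℝ) : rieszTerm ε N n x ≤ rieszMajorant ε N n x := by
  have hL := one_le_llogLNorm_rieszProd ε (N n)
  unfold rieszTerm rieszMajorant
  gcongr
  exact (le_abs_self _).trans (abs_le_llogl _ x)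

theorem rieszMajorant_nonneg {ε : ℝ} (hε0 : 0 < ε) (hε1 : ε < 1) (N : ℕ → ℕ) (n : ℕ)
    (x : ℝ) : 0 ≤ rieszMajorant ε N n x :=
  (rieszTerm_pos hε0 hε1 N n x).le.trans (rieszTerm_le_rieszMajorant ε N n x)

/-- By the normalization the term of index `n` has integral `2^{-n}`. This one identity gives both
convergence almost everywhere and membership in `L log L`. -/
theorem lintegral_tsum_rieszMajorant {ε : ℝ} (hε0 : 0 < ε) (hε1 : ε < 1) (N : ℕ → ℕ) :
    ∫⁻ x, ∑' n : ℕ, ENNReal.ofReal (rieszMajorant ε N (n + 1) x) ∂periodMeasure = 1 := by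
  have hc : ∀ n, Continuous (rieszMajorant ε N n) := fun n => by
    have := continuous_llogl (continuous_rieszProd ε (N n))
    unfold rieszMajorant
    fun_prop
  rw [lintegral_tsum fun n => (hc _).measurable.ennreal_ofReal.aemeasurable]
  have h : ∀ n : ℕ, ∫⁻ x, ENNReal.ofReal (rieszMajorant ε N (n + 1) x) ∂periodMeasure =
      ENNReal.ofReal ((2 : ℝ)⁻¹ ^ (n + 1)) := by
    intro n
    rw [← ofReal_integral_eq_lintegral_ofReal (hc _).integrable_periodMeasure
      (Eventually.of_forall fun x => rieszMajorant_nonneg hε0 hε1 N _ x)]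
    congr 1
    have hL := one_le_llogLNorm_rieszProd ε (N (n + 1))
    simp only [rieszMajorant]
    rw [integral_const_mul, integral_div]
    change _ * (llogLNorm (rieszProd ε (N (n + 1))) / _) = _
    rw [div_self (by linarith), mul_one]
  simp only [h]
  rw [← ENNReal.ofReal_tsum_of_nonneg (fun n => by positivity) hasSum_two_inv_pow_succ.summable,
    hasSum_two_inv_pow_succ.tsum_eq, ENNReal.ofReal_one]

theorem ae_summable_rieszMajorant {ε : ℝ} (hε0 : 0 < ε) (hε1 : ε < 1) (N : ℕ → ℕ) :
    ∀ᵐ x ∂periodMeasure, Summable fun n : ℕ => rieszMajorant ε N (n + 1) x := by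
  have hm : AEMeasurable (fun x => ∑' n : ℕ, ENNReal.ofReal (rieszMajorant ε N (n + 1) x))
      periodMeasure := by
    refine AEMeasurable.tsum fun n => Measurable.aemeasurable ?_
    have := continuous_llogl (continuous_rieszProd ε (N (n + 1)))
    unfold rieszMajorant
    fun_prop
  filter_upwards [ae_lt_top' hm (by rw [lintegral_tsum_rieszMajorant hε0 hε1]; simp)] with x hx
  have h := ENNReal.summable_toReal hx.ne
  simpa only [ENNReal.toReal_ofReal (rieszMajorant_nonneg hε0 hε1 N _ x)] using h

theorem summable_rieszTerm {ε : ℝ} (hε0 : 0 < ε) (hε1 : ε < 1) {N : ℕ → ℕ} {x : ℝ}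
    (h : Summable fun n : ℕ => rieszMajorant ε N (n + 1) x) :
    Summable fun n : ℕ => rieszTerm ε N (n + 1) x :=
  h.of_nonneg_of_le (fun _ => (rieszTerm_pos hε0 hε1 N _ x).le)
    fun _ => rieszTerm_le_rieszMajorant ε N _ x

theorem llogl_rieszSum_le {ε : ℝ} (hε0 : 0 < ε) (hε1 : ε < 1) {N : ℕ → ℕ} {x : ℝ}
    (h : Summable fun n : ℕ => rieszMajorant ε N (n + 1) x) :
    llogl (rieszSum ε N) x ≤ ∑' n : ℕ, rieszMajorant ε N (n + 1) x := by
  set v : ℕ → ℝ := fun n => rieszProd ε (N (n + 1)) x / llogLNorm (rieszProd ε (N (n + 1)))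
  have hv : ∀ n, 0 ≤ v n := fun n => div_nonneg (rieszProd_pos hε0 hε1 _ x).le
    (zero_le_one.trans (one_le_llogLNorm_rieszProd ε _))
  have hle : ∀ n, (2 : ℝ)⁻¹ ^ (n + 1) * (v n * Real.log (Real.exp 1 + v n)) ≤
      rieszMajorant ε N (n + 1) x := fun n =>
    mul_le_mul_of_nonneg_left (mul_log_normalized_le hε0 hε1 _ x) (by positivity)
  have hs' : Summable fun n => (2 : ℝ)⁻¹ ^ (n + 1) * (v n * Real.log (Real.exp 1 + v n)) := by
    refine h.of_nonneg_of_le (fun n => ?_) hle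
    have := one_le_log_exp_one_add (hv n)
    have := hv n
    positivity
  have hj := mul_log_tsum_le (fun n => by positivity) hasSum_two_inv_pow_succ hv
    (summable_rieszTerm hε0 hε1 h) hs'
  rw [llogl, abs_of_nonneg (rieszSum_nonneg hε0 hε1 N x)]
  exact hj.trans (hs'.tsum_le_tsum hle h)

theorem lintegral_llogl_rieszSum_le {ε : ℝ} (hε0 : 0 < ε) (hε1 : ε < 1) (N : ℕ → ℕ) :
    ∫⁻ x, ENNReal.ofReal (llogl (rieszSum ε N) x) ∂periodMeasure ≤ 1 := by
  rw [← lintegral_tsum_rieszMajorant hε0 hε1 N]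
  refine lintegral_mono_ae ?_
  filter_upwards [ae_summable_rieszMajorant hε0 hε1 N] with x hx
  rw [← ENNReal.ofReal_tsum_of_nonneg (fun n => rieszMajorant_nonneg hε0 hε1 N _ x) hx]
  exact ENNReal.ofReal_le_ofReal (llogl_rieszSum_le hε0 hε1 hx)

theorem measurable_llogl {g : ℝ → ℝ} (hg : Measurable g) : Measurable (llogl g) := by
  unfold llogl
  have : Measurable fun x => |g x| := hg.abs
  exact this.mul (Real.measurable_log.comp (this.const_add _))

theorem memLlogL_rieszSum {ε : ℝ} (hε0 : 0 < ε) (hε1 : ε < 1) (N : ℕ → ℕ) :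
    MemLlogL (rieszSum ε N) := by
  have hm := measurable_rieszSum hε0 hε1 N
  refine ⟨hm.aestronglyMeasurable, (measurable_llogl hm).aestronglyMeasurable, ?_⟩
  rw [hasFiniteIntegral_iff_ofReal (Eventually.of_forall fun x => llogl_nonneg _ x)]
  exact (lintegral_llogl_rieszSum_le hε0 hε1 N).trans_lt (by simp)

theorem ae_of_ae_periodMeasure {p : ℝ → Prop} (hp : ∀ (x : ℝ) (k : ℤ), p (x + k * (2 * π)) → p x)
    (h : ∀ᵐ x ∂periodMeasure, p x) : ∀ᵐ x, p x := by
  rw [periodMeasure, ae_restrict_iff' measurableSet_Ico, ae_iff] at h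
  rw [ae_iff]
  have hcov : {x | ¬ p x} ⊆ ⋃ k : ℤ, (fun x => x + k * (2 * π)) ⁻¹'
      {x | ¬ (x ∈ Ico 0 (2 * π) → p x)} := by
    intro x hx
    obtain ⟨k, hk, -⟩ := existsUnique_add_zsmul_mem_Ico Real.two_pi_pos x 0
    rw [zsmul_eq_mul, zero_add] at hk
    exact mem_iUnion.2 ⟨k, fun h => hx (hp x k (h hk))⟩
  refine measure_mono_null hcov (measure_iUnion_null fun k => ?_)
  rw [measure_preimage_add_right]
  exact h

theorem ae_summable_rieszTerm {ε : ℝ} (hε0 : 0 < ε) (hε1 : ε < 1) (N : ℕ → ℕ) :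
    ∀ᵐ x : ℝ, Summable fun n : ℕ => rieszTerm ε N (n + 1) x := by
  refine ae_of_ae_periodMeasure (fun x k h => ?_) ?_
  · simpa only [(rieszTerm_periodic ε N _).int_mul k x] using h
  · filter_upwards [ae_summable_rieszMajorant hε0 hε1 N] with x hx
    exact summable_rieszTerm hε0 hε1 hx

/-- Holds at every point: translating back by `-τ` carries convergence from `t + τ` to `t`, and
where the series diverges at `t + τ` its value there is 0 by convention. -/
theorem rieszSum_add_le {ε : ℝ} (hε0 : 0 < ε) (hε1 : ε < 1) (N : ℕ → ℕ) (k : ℕ) {τ : ℝ}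
    (hτ : |τ| = 2 * π / 3 ^ k) (t : ℝ) :
    rieszSum ε N (t + τ) ≤ Real.exp (ε / (1 - ε) * π) * rieszSum ε N t := by
  have hterm : ∀ {τ : ℝ}, |τ| = 2 * π / 3 ^ k → ∀ t n,
      rieszTerm ε N n (t + τ) ≤ Real.exp (ε / (1 - ε) * π) * rieszTerm ε N n t := by
    intro τ hτ t n
    have hL := one_le_llogLNorm_rieszProd ε (N n)
    have h := rieszProd_add_le hε0 hε1 (N n) k hτ t
    unfold rieszTerm
    calc _ ≤ (2 : ℝ)⁻¹ ^ n * (Real.exp (ε / (1 - ε) * π) * rieszProd ε (N n) t /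
          llogLNorm (rieszProd ε (N n))) := by gcongr
      _ = _ := by ring
  by_cases hs : Summable fun n : ℕ => rieszTerm ε N (n + 1) (t + τ)
  · have hs' : Summable fun n : ℕ => rieszTerm ε N (n + 1) t := by
      refine (hs.mul_left (Real.exp (ε / (1 - ε) * π))).of_nonneg_of_le
        (fun n => (rieszTerm_pos hε0 hε1 N _ t).le) fun n => ?_
      have := hterm (τ := -τ) (by rwa [abs_neg]) (t + τ) (n + 1)
      rwa [add_neg_cancel_right] at this
    rw [rieszSum, rieszSum, ← tsum_mul_left]
    exact hs.tsum_le_tsum (fun n => hterm hτ t (n + 1)) (hs'.mul_left _)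
  · rw [rieszSum, tsum_eq_zero_of_not_summable hs]
    exact mul_nonneg (Real.exp_pos _).le (rieszSum_nonneg hε0 hε1 N t)

/-! ### The sum lies in no `L^p` with `p > 1`. -/

/-- With `z = P^(1/(8n))`, `log(1 + P) ≤ 8n log(1 + z) ≤ 8n z`, and `z ≤ y + z^8 / y^7` according to
whether `z ≤ y`. After multiplication by `P`, `z^8 = P^(1/n)` produces exactly `P^(1+1/n)`; `y` is
free to balance the two terms. -/
theorem log_exp_one_add_le {P y : ℝ} (hP : 0 ≤ P) (hy : 0 < y) {n : ℕ} (hn : 1 ≤ n) :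
    Real.log (Real.exp 1 + P) ≤ 1 + 8 * n * (y + P ^ (1 / (n : ℝ)) / y ^ 7) := by
  have hn' : (0 : ℝ) < n := by exact_mod_cast hn
  set z := P ^ (1 / (8 * n : ℝ)) with hz
  have hz0 : 0 ≤ z := by positivity
  have hzP : z ^ (8 * n) = P := by
    rw [hz, ← Real.rpow_natCast, ← Real.rpow_mul hP]
    push_cast
    rw [one_div_mul_cancel (by positivity), Real.rpow_one]
  have hz8 : z ^ 8 = P ^ (1 / (n : ℝ)) := by
    rw [hz, ← Real.rpow_natCast, ← Real.rpow_mul hP]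
    congr 1
    push_cast; field_simp
  have h1 : Real.log (Real.exp 1 + P) ≤ 1 + Real.log (1 + P) := by
    have : Real.log (Real.exp 1 * (1 + P)) = 1 + Real.log (1 + P) := by
      rw [Real.log_mul (Real.exp_pos 1).ne' (by positivity), Real.log_exp]
    rw [← this]
    refine Real.log_le_log (by positivity) ?_
    nlinarith [Real.add_one_le_exp 1]
  have h2 : Real.log (1 + P) ≤ 8 * n * z := by
    have h3 : 1 + P ≤ (1 + z) ^ (8 * n) := by
      have := pow_add_pow_le (zero_le_one' ℝ) hz0 (n := 8 * n) (by omega)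
      rwa [one_pow, hzP] at this
    have h4 := Real.log_le_log (by positivity) h3
    rw [Real.log_pow] at h4
    have h5 : Real.log (1 + z) ≤ z := by
      have := Real.log_le_sub_one_of_pos (show 0 < 1 + z by positivity)
      linarith
    refine h4.trans ?_
    push_cast
    gcongr
  have h6 : z ≤ y + z ^ 8 / y ^ 7 := by
    rcases le_total z y with h | h
    · have : 0 ≤ z ^ 8 / y ^ 7 := by positivity
      linarith
    · have : z ≤ z ^ 8 / y ^ 7 := by
        rw [le_div_iff₀ (by positivity), show z ^ 8 = z * z ^ 7 by ring]
        gcongr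
      linarith
  rw [hz8] at h6
  have := mul_le_mul_of_nonneg_left h6 (show (0 : ℝ) ≤ 8 * n by positivity)
  linarith

/-- The normalizing constant costs only an eighth root of `∫ P^(1+1/n)`, up to the factor `100 n`.
-/
theorem llogLNorm_rieszProd_le {ε : ℝ} (hε0 : 0 < ε) (hε1 : ε < 1) (m : ℕ) {n : ℕ} (hn : 1 ≤ n)
    {y : ℝ} (hy : 1 ≤ y)
    (hI : ∫ t in (0 : ℝ)..2 * π, rieszProd ε m t ^ (1 + 1 / (n : ℝ)) ≤ y ^ 8) :
    llogLNorm (rieszProd ε m) ≤ 100 * n * y := by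
  have hn' : (1 : ℝ) ≤ n := by exact_mod_cast hn
  have hPc := continuous_rieszProd ε m
  have hP0 := rieszProd_pos hε0 hε1 m
  have hPq : Continuous fun t => rieszProd ε m t ^ (1 + 1 / (n : ℝ)) :=
    hPc.rpow_const fun t => Or.inl (hP0 t).ne'
  have hpt : ∀ t, llogl (rieszProd ε m) t ≤ (1 + 8 * n * y) * rieszProd ε m t +
      8 * n / y ^ 7 * rieszProd ε m t ^ (1 + 1 / (n : ℝ)) := by
    intro t
    rw [llogl, abs_of_pos (hP0 t)]
    refine (mul_le_mul_of_nonneg_left (log_exp_one_add_le (hP0 t).le (by linarith : 0 < y) hn)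
      (hP0 t).le).trans (le_of_eq ?_)
    rw [Real.rpow_add (hP0 t), Real.rpow_one]
    ring
  rw [llogLNorm, integral_periodMeasure]
  have h := intervalIntegral.integral_mono_on (μ := volume) (a := 0) (b := 2 * π) (by positivity)
    ((continuous_llogl hPc).intervalIntegrable _ _)
    (Continuous.intervalIntegrable (by fun_prop) _ _) (fun t _ => hpt t)
  rw [intervalIntegral.integral_add (Continuous.intervalIntegrable (by fun_prop) _ _)
    (Continuous.intervalIntegrable (by fun_prop) _ _), intervalIntegral.integral_const_mul,
    intervalIntegral.integral_const_mul, integral_rieszProd] at h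
  have h2 : 8 * n / y ^ 7 * ∫ t in (0 : ℝ)..2 * π, rieszProd ε m t ^ (1 + 1 / (n : ℝ)) ≤
      8 * n * y := by
    calc _ ≤ 8 * n / y ^ 7 * y ^ 8 := by gcongr
      _ = _ := by field_simp
  have h3 : (1 : ℝ) ≤ n * y := one_le_mul_of_one_le_of_one_le hn' hy
  nlinarith [Real.pi_lt_d2]

/-- Let `A ≥ 4^n` be the `L^{1+1/n}` norm of `P_{N_n}` and `y = A^(1/4)`, so `y² ≥ 2^n` and `∫
P^(1+1/n) ≤ A² = y^8`. The term of index `n` has norm at least `2^{-n} y^4 / (100 n y) ≥ y / (100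
n)`. Terms are positive, so membership in `L^p` would bound this by a constant as soon as `1 + 1/n <
p`, whence `2^n = O(n²)`. -/
theorem not_memLp_rieszSum {ε : ℝ} (hε0 : 0 < ε) (hε1 : ε < 1) {N : ℕ → ℕ}
    (hN : FastGrowth ε N) {p : ℝ≥0∞} (hp : 1 < p) :
    ¬ MemLp (rieszSum ε N) p periodMeasure := by
  intro hmem
  set M : ℝ := (eLpNorm (rieszSum ε N) p periodMeasure * periodMeasure univ).toReal with hM
  have hMt : eLpNorm (rieszSum ε N) p periodMeasure * periodMeasure univ ≠ ∞ :=
    ENNReal.mul_ne_top hmem.2.ne (measure_ne_top _ _)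
  have hbig : ∀ᶠ n : ℕ in atTop, (2 : ℝ) ^ n ≤ (100 * M) ^ 2 * (n : ℝ) ^ 2 := by
    have hev : ∀ᶠ n : ℕ in atTop, ENNReal.ofReal (1 + 1 / (n : ℝ)) < p := by
      have : Tendsto (fun n : ℕ => ENNReal.ofReal (1 + 1 / (n : ℝ))) atTop (𝓝 1) := by
        have h := (tendsto_const_nhds (x := (1 : ℝ))).add (tendsto_one_div_atTop_nhds_zero_nat (𝕜 := ℝ))
        simpa using ENNReal.tendsto_ofReal h
      exact this.eventually (gt_mem_nhds hp)
    filter_upwards [hev, eventually_ge_atTop 1] with n hnp hn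
    have hn' : (1 : ℝ) ≤ n := by exact_mod_cast hn
    set q : ℝ := 1 + 1 / (n : ℝ) with hq
    have hq1 : 1 ≤ q := by
      have : 0 ≤ 1 / (n : ℝ) := by positivity
      linarith
    have hq2 : q ≤ 2 := by
      have : 1 / (n : ℝ) ≤ 1 := by rw [div_le_one (by linarith)]; exact hn'
      linarith
    set P := rieszProd ε (N n) with hP
    set I := ∫ t in (0 : ℝ)..2 * π, P t ^ q with hI
    set A := I ^ (1 / q) with hA
    have hI0 : 0 ≤ I := intervalIntegral.integral_nonneg (by positivity) fun t _ =>
      Real.rpow_nonneg (rieszProd_pos hε0 hε1 _ t).le _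
    have hA4 : (4 : ℝ) ^ n ≤ A := by
      have h := hN n hn
      rw [eLpNorm_rieszProd hε0 hε1 (N n) (by linarith)] at h
      rw [show (4 : ℝ≥0∞) ^ n = ENNReal.ofReal ((4 : ℝ) ^ n) by
        rw [ENNReal.ofReal_pow (by norm_num)]; simp] at h
      exact (ENNReal.ofReal_le_ofReal_iff (by positivity)).1 h
    have hA1 : 1 ≤ A := (one_le_pow₀ (by norm_num)).trans hA4
    set y := A ^ (1 / 4 : ℝ) with hy
    have hy1 : 1 ≤ y := Real.one_le_rpow hA1 (by norm_num)
    have hyA : y ^ 4 = A := by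
      rw [hy, ← Real.rpow_natCast, ← Real.rpow_mul (by linarith)]; norm_num
    have hIy : I ≤ y ^ 8 := by
      have h1 : I = A ^ q := by
        rw [hA, ← Real.rpow_mul hI0, one_div_mul_cancel (by linarith), Real.rpow_one]
      calc I ≤ A ^ (2 : ℝ) := by rw [h1]; exact Real.rpow_le_rpow_of_exponent_le hA1 hq2
        _ = y ^ 8 := by rw [Real.rpow_two, ← hyA]; ring
    have hL := llogLNorm_rieszProd_le hε0 hε1 (N n) hn hy1 hIy
    have hL1 := one_le_llogLNorm_rieszProd ε (N n)
    have hterm : ENNReal.ofReal ((2 : ℝ)⁻¹ ^ n / llogLNorm P * A) ≤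
        eLpNorm (rieszSum ε N) p periodMeasure * periodMeasure univ := by
      have h1 : eLpNorm (rieszTerm ε N n) (ENNReal.ofReal q) periodMeasure =
          ENNReal.ofReal ((2 : ℝ)⁻¹ ^ n / llogLNorm P * A) := by
        have : rieszTerm ε N n = ((2 : ℝ)⁻¹ ^ n / llogLNorm P) • P := by
          ext x; simp only [rieszTerm, Pi.smul_apply, smul_eq_mul, hP]; ring
        rw [this, eLpNorm_const_smul, eLpNorm_rieszProd hε0 hε1 (N n) (by linarith),
          Real.enorm_of_nonneg (by positivity), ENNReal.ofReal_mul (by positivity)]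
      rw [← h1]
      have h2 : eLpNorm (rieszTerm ε N n) (ENNReal.ofReal q) periodMeasure ≤
          eLpNorm (rieszSum ε N) (ENNReal.ofReal q) periodMeasure := by
        refine eLpNorm_mono_ae ?_
        filter_upwards [ae_summable_rieszMajorant hε0 hε1 N] with x hx
        rw [Real.norm_of_nonneg (rieszTerm_pos hε0 hε1 N n x).le,
          Real.norm_of_nonneg (rieszSum_nonneg hε0 hε1 N x)]
        have h := (summable_rieszTerm hε0 hε1 hx).le_tsum (n - 1)
          (fun j _ => (rieszTerm_pos hε0 hε1 N _ x).le)
        rwa [Nat.sub_add_cancel hn] at h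
      refine h2.trans ((eLpNorm_le_eLpNorm_mul_rpow_measure_univ hnp.le hmem.1).trans ?_)
      gcongr
      have hμ : 1 ≤ periodMeasure univ := by
        rw [periodMeasure, Measure.restrict_apply_univ, Real.volume_Ico, ← ENNReal.ofReal_one]
        exact ENNReal.ofReal_le_ofReal (by linarith [Real.pi_gt_three])
      refine (ENNReal.rpow_le_rpow_of_exponent_le hμ (y := _) (z := 1) ?_).trans_eq
        (ENNReal.rpow_one _)
      have h3 : 1 / q ≤ 1 := by rw [div_le_one (by linarith)]; exact hq1
      -- For `p = ∞` this quotient is 0 by convention, so the case needs no separate treatment.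
      have h4 : 0 ≤ 1 / p.toReal := by positivity
      rw [ENNReal.toReal_ofReal (by linarith)]
      linarith
    have hreal : (2 : ℝ)⁻¹ ^ n / llogLNorm P * A ≤ M :=
      (ENNReal.ofReal_le_iff_le_toReal hMt).1 hterm
    have hy2 : (2 : ℝ) ^ n ≤ y ^ 2 := by
      refine le_of_sq_le_sq ?_ (by positivity)
      calc ((2 : ℝ) ^ n) ^ 2 = 4 ^ n := by rw [← pow_mul, mul_comm, pow_mul]; norm_num
        _ ≤ A := hA4
        _ = (y ^ 2) ^ 2 := by rw [← hyA]; ring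
    have hyM : y ≤ 100 * M * n := by
      have h5 : y / (100 * n) ≤ (2 : ℝ)⁻¹ ^ n / llogLNorm P * A := by
        calc y / (100 * n) = 1 * (y / (100 * n)) := by ring
          _ ≤ ((2 : ℝ)⁻¹ ^ n * y ^ 2) * (y / (100 * n)) := by
              gcongr
              rw [inv_pow, inv_mul_eq_div, le_div_iff₀ (by positivity), one_mul]
              exact hy2
          _ = (2 : ℝ)⁻¹ ^ n / (100 * n * y) * A := by rw [← hyA]; field_simp
          _ ≤ _ := by gcongr
      have h6 := h5.trans hreal
      rw [div_le_iff₀ (by positivity)] at h6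
      linarith
    calc (2 : ℝ) ^ n ≤ y ^ 2 := hy2
      _ ≤ (100 * M * n) ^ 2 := by gcongr
      _ = _ := by ring
  have hlim := (tendsto_pow_const_div_const_pow_of_one_lt 2 (r := (2 : ℝ)) (by norm_num)).const_mul
    ((100 * M) ^ 2)
  rw [mul_zero] at hlim
  obtain ⟨n, h1, h2⟩ := (hbig.and (hlim.eventually (gt_mem_nhds one_pos))).exists
  rw [← mul_div_assoc, div_lt_one (by positivity)] at h2
  linarith

end riesz

/-! ### Periodic maximal functions, doubling, and the weight `ω`. -/

section periodic
open Set Filter Topology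
open scoped ENNReal Real

theorem Function.Periodic.setLIntegral_Ioc_eq {Φ : ℝ → ℝ≥0∞} {T : ℝ} (hT : 0 < T)
    (hΦ : Function.Periodic Φ T) (a b : ℝ) :
    ∫⁻ x in Ioc a (a + T), Φ x = ∫⁻ x in Ioc b (b + T), Φ x :=
  (isAddFundamentalDomain_Ioc hT a).setLIntegral_eq (isAddFundamentalDomain_Ioc hT b) _
    hΦ.map_vadd_zmultiples

theorem Function.Periodic.setLIntegral_Ioc_nat_mul {Φ : ℝ → ℝ≥0∞} {T : ℝ} (hT : 0 < T)
    (hΦ : Function.Periodic Φ T) (a : ℝ) (n : ℕ) :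
    ∫⁻ x in Ioc a (a + n * T), Φ x = n * ∫⁻ x in Ioc 0 (0 + T), Φ x := by
  induction n with
  | zero => simp
  | succ n ih =>
    have h1 : Ioc a (a + (n + 1 : ℕ) * T) =
        Ioc a (a + n * T) ∪ Ioc (a + n * T) (a + n * T + T) := by
      have : (0 : ℝ) ≤ n * T := by positivity
      rw [Ioc_union_Ioc_eq_Ioc (by linarith) (by linarith)]
      push_cast; ring_nf
    rw [h1, lintegral_union measurableSet_Ioc, ih, hΦ.setLIntegral_Ioc_eq hT (a + n * T) 0]
    · push_cast; ring
    · exact Ioc_disjoint_Ioc_of_le le_rfl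

theorem setLIntegral_Ico_eq_Ioc {a b : ℝ} (Φ : ℝ → ℝ≥0∞) :
    ∫⁻ x in Ico a b, Φ x = ∫⁻ x in Ioc a b, Φ x := setLIntegral_congr Ico_ae_eq_Ioc

theorem avgSup_periodic {F : ℝ → ℝ≥0∞} {T : ℝ} (hF : Function.Periodic F T) :
    Function.Periodic (avgSup F) T := by
  intro x
  refine le_antisymm ?_ ?_
  · simpa using avgSup_add_le (C := 1) ENNReal.one_ne_top (fun t => by rw [hF t, one_mul]) x
  · have h := avgSup_add_le (F := F) (C := 1) (τ := -T) ENNReal.one_ne_top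
      (fun t => by rw [one_mul, ← sub_eq_add_neg, hF.sub_eq]) (x + T)
    simpa using h

/-- For a periodic function, only intervals shorter than the period matter, up to the mean. -/
theorem avgSup_le_max_of_periodic {F : ℝ → ℝ≥0∞} {T : ℝ} (hT : 0 < T)
    (hF : Function.Periodic F T) {x : ℝ} (hx : x ∈ Icc 0 T) :
    avgSup F x ≤ max (2 * (∫⁻ t in Ioc 0 (0 + T), F t) / ENNReal.ofReal T)
      (avgSup ((Ioc (-T) (-T + (3 : ℕ) * T)).indicator F) x) := by
  rw [avgSup_le_iff]
  intro a b hab hxab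
  rcases le_total T (b - a) with h | h
  · refine le_trans ?_ (mul_le_mul_left (le_max_left _ _) _)
    -- An interval of at least one period is covered by `⌈(b - a) / T⌉ ≤ 2 (b - a) / T` periods,
    -- which bounds its mean by twice the mean over a period.
    have h1 : (b - a) / T ≤ ⌈(b - a) / T⌉₊ := Nat.le_ceil _
    have h2 : (⌈(b - a) / T⌉₊ : ℝ) < (b - a) / T + 1 :=
      Nat.ceil_lt_add_one (div_nonneg (by linarith) hT.le)
    have h3 : 1 ≤ (b - a) / T := by rwa [le_div_iff₀ hT, one_mul]
    rw [div_le_iff₀ hT] at h1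
    calc ∫⁻ t in Icc a b, F t = ∫⁻ t in Ioc a b, F t := setLIntegral_congr Ioc_ae_eq_Icc.symm
      _ ≤ ∫⁻ t in Ioc a (a + ⌈(b - a) / T⌉₊ * T), F t :=
          lintegral_mono_set (Ioc_subset_Ioc_right (by linarith))
      _ = ⌈(b - a) / T⌉₊ * ∫⁻ t in Ioc 0 (0 + T), F t := hF.setLIntegral_Ioc_nat_mul hT _ _
      _ ≤ ENNReal.ofReal (2 * ((b - a) / T)) * ∫⁻ t in Ioc 0 (0 + T), F t := by
          gcongr
          rw [← ENNReal.ofReal_natCast]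
          exact ENNReal.ofReal_le_ofReal (by linarith)
      _ = _ := by
          rw [ENNReal.ofReal_mul (by norm_num), ENNReal.ofReal_div_of_pos hT, ENNReal.ofReal_ofNat,
            div_eq_mul_inv, div_eq_mul_inv]
          ring
  · refine le_trans ?_ (mul_le_mul_left (le_max_right _ _) _)
    refine le_trans (le_of_eq ?_) (lintegral_Icc_le_avgSup_mul hab hxab)
    rw [setLIntegral_indicator measurableSet_Ioc]
    have hsub : Ioc a b ⊆ Ioc (-T) (-T + (3 : ℕ) * T) := by
      have := hx.1; have := hx.2; have := hxab.1; have := hxab.2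
      refine Ioc_subset_Ioc (by linarith) ?_
      push_cast; linarith
    have h1 : ∫⁻ t in Icc a b, F t = ∫⁻ t in Ioc a b, F t := setLIntegral_congr Ioc_ae_eq_Icc.symm
    have h2 : (Ioc (-T) (-T + (3 : ℕ) * T) ∩ Icc a b : Set ℝ) =ᵐ[volume] Ioc a b := by
      have h3 : (Ioc (-T) (-T + (3 : ℕ) * T) ∩ Icc a b : Set ℝ) =ᵐ[volume]
          (Ioc (-T) (-T + (3 : ℕ) * T) ∩ Ioc a b : Set ℝ) :=
        (ae_eq_refl _).inter Ioc_ae_eq_Icc.symm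
      rwa [inter_eq_self_of_subset_right hsub] at h3
    rw [h1, setLIntegral_congr h2]

/-- A nonzero periodic function is not in `L log L` of the line. Over one period only its
restriction to three periods matters, up to an additive constant. -/
theorem setLIntegral_maximalFn_ne_top_of_periodic {g : ℝ → ℝ} {T : ℝ} (hT : 0 < T)
    (hg : Measurable g) (hp : Function.Periodic g T)
    (hint : ∫⁻ x in Ioc 0 (0 + T), ENNReal.ofReal (llogl g x) ≠ ∞) :
    ∫⁻ x in Ioc 0 (0 + T), maximalFn g x ≠ ∞ := by
  rw [maximalFn_eq_avgSup]
  set J : Set ℝ := Ioc (-T) (-T + (3 : ℕ) * T) with hJ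
  have hpF : Function.Periodic (fun x => ‖g x‖ₑ) T := fun x => by simp only [hp x]
  have hpΦ : Function.Periodic (fun x => ENNReal.ofReal (llogl g x)) T := fun x => by
    simp only [llogl, hp x]
  have h1 : ∫⁻ x in Ioc 0 (0 + T), ‖g x‖ₑ ≠ ∞ := by
    refine ne_top_of_le_ne_top hint (lintegral_mono fun x => ?_)
    rw [Real.enorm_eq_ofReal_abs]
    exact ENNReal.ofReal_le_ofReal (abs_le_llogl g x)
  have hind : J.indicator (fun x => ‖g x‖ₑ) = fun x => ‖J.indicator g x‖ₑ := by
    ext x; rw [enorm_indicator_eq_indicator_enorm]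
  have h2 : ∫⁻ x in Ioc 0 (0 + T), avgSup (J.indicator fun x => ‖g x‖ₑ) x ≠ ∞ := by
    rw [hind]
    refine setLIntegral_avgSup_ne_top (hg.indicator measurableSet_Ioc).aemeasurable ?_ (by simp)
    have h3 : (fun x => ENNReal.ofReal (llogl (J.indicator g) x)) =
        J.indicator fun x => ENNReal.ofReal (llogl g x) := by
      ext x
      by_cases hx : x ∈ J <;> simp [llogl, hx]
    rw [h3, lintegral_indicator measurableSet_Ioc, hpΦ.setLIntegral_Ioc_nat_mul hT]
    exact ENNReal.mul_ne_top (by simp) hint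
  have h3 : 2 * (∫⁻ x in Ioc 0 (0 + T), ‖g x‖ₑ) / ENNReal.ofReal T ≠ ∞ :=
    ENNReal.div_ne_top (ENNReal.mul_ne_top (by simp) h1) (ENNReal.ofReal_pos.2 hT).ne'
  refine ne_top_of_le_ne_top (ENNReal.add_ne_top.2 ⟨ENNReal.mul_ne_top h3
    (measure_Ioc_lt_top (a := 0) (b := 0 + T) (μ := (volume : Measure ℝ))).ne, h2⟩) ?_
  rw [← setLIntegral_const, ← lintegral_add_left measurable_const]
  refine setLIntegral_mono' measurableSet_Ioc fun x hx => ?_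
  refine (avgSup_le_max_of_periodic hT hpF ⟨hx.1.le, by simpa using hx.2⟩).trans ?_
  exact max_le le_self_add le_add_self

/-- A continuous minorant of a function is a minorant of its maximal function, everywhere. -/
theorem ofReal_le_avgSup_of_ae_le {F : ℝ → ℝ≥0∞} {g : ℝ → ℝ} (hg : Continuous g)
    (h : ∀ᵐ x, ENNReal.ofReal (g x) ≤ F x) (x : ℝ) : ENNReal.ofReal (g x) ≤ avgSup F x := by
  refine le_of_forall_lt fun l hl => ?_
  obtain ⟨l', hl1, hl2⟩ := exists_between hl
  have hc : Continuous fun t => ENNReal.ofReal (g t) := ENNReal.continuous_ofReal.comp hg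
  obtain ⟨b, hb, hsub⟩ := mem_nhdsGE_iff_exists_Icc_subset.1
    (mem_nhdsWithin_of_mem_nhds (s := {t | l' < ENNReal.ofReal (g t)})
      (hc.continuousAt.eventually (lt_mem_nhds hl2)))
  have hb : x < b := hb
  refine lt_avgSup_iff.2 ⟨x, b, hb, ⟨le_rfl, hb.le⟩, ?_⟩
  calc l * ENNReal.ofReal (b - x) < l' * ENNReal.ofReal (b - x) :=
        ENNReal.mul_lt_mul_left (by simpa using hb) ENNReal.ofReal_ne_top hl1
    _ = ∫⁻ _ in Icc x b, l' := by rw [setLIntegral_const, Real.volume_Icc]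
    _ ≤ ∫⁻ t in Icc x b, F t := by
        refine setLIntegral_mono_ae' measurableSet_Icc ?_
        filter_upwards [h] with t ht hmem
        exact (show l' < ENNReal.ofReal (g t) from hsub hmem).le.trans ht

/-- A weight that is quasi-invariant under triadic translations is doubling. -/
theorem setLIntegral_Ioc_add_le_of_quasiInvariant {ω : ℝ → ℝ≥0∞} {C : ℝ≥0∞}
    (hC1 : 1 ≤ C) (hC : C ≠ ∞)
    (h : ∀ (k : ℕ) (τ : ℝ), |τ| = 2 * π / 3 ^ k → ∀ x, ω (x + τ) ≤ C * ω x)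
    {a t σ : ℝ} (ht0 : 0 < t) (htπ : t ≤ π) (hσ : |σ| = 1) :
    ∫⁻ x in Ioc (a + σ * t) (a + σ * t + t), ω x ≤ 3 * C ^ 3 * ∫⁻ x in Ioc a (a + t), ω x := by
  -- With `τ ≤ t < 3τ` for `τ = 2π/3^k`, the translates by `τ`, `2τ`, `3τ` overlap and together
  -- cover the adjacent interval. For `k = 0` the upper bound follows from `t ≤ π`.
  obtain ⟨k, hk1, hk2⟩ : ∃ k : ℕ, 2 * π / 3 ^ k ≤ t ∧ t < 3 * (2 * π / 3 ^ k) := by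
    have hex : ∃ k : ℕ, 2 * π / 3 ^ k ≤ t := by
      obtain ⟨k, hk⟩ := pow_unbounded_of_one_lt (2 * π / t) (by norm_num : (1 : ℝ) < 3)
      refine ⟨k, ?_⟩
      rw [div_lt_iff₀ ht0] at hk
      rw [div_le_iff₀ (by positivity)]
      linarith
    classical
    refine ⟨Nat.find hex, Nat.find_spec hex, ?_⟩
    rcases Nat.eq_zero_or_pos (Nat.find hex) with h0 | h0
    · rw [h0]; norm_num; linarith [Real.pi_pos]
    · obtain ⟨m, hm⟩ := Nat.exists_eq_succ_of_ne_zero h0.ne'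
      have := Nat.find_min hex (m := m) (by omega)
      push Not at this
      rw [hm, pow_succ]
      refine this.trans_le (le_of_eq ?_)
      field_simp
  set τ := 2 * π / 3 ^ k with hτ
  have hτ0 : 0 < τ := by positivity
  have hstep : ∀ x, ω (x + σ * τ) ≤ C * ω x :=
    h k (σ * τ) (by rw [abs_mul, hσ, one_mul, abs_of_pos hτ0])
  have hiter : ∀ (j : ℕ) x, ω (x + j * (σ * τ)) ≤ C ^ j * ω x := by
    intro j
    induction j with
    | zero => simp
    | succ j ih =>
      intro x
      have := hstep (x + j * (σ * τ))
      rw [show x + (j + 1 : ℕ) * (σ * τ) = x + j * (σ * τ) + σ * τ by push_cast; ring]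
      refine this.trans ((mul_le_mul_right (ih x) _).trans (le_of_eq ?_))
      ring
  have hpiece : ∀ j : ℕ, j ≤ 3 → ∫⁻ x in Ioc (a + j * (σ * τ)) (a + t + j * (σ * τ)), ω x ≤
      C ^ 3 * ∫⁻ x in Ioc a (a + t), ω x := by
    intro j hj
    have hsh := lintegral_Icc_sub ω (a + j * (σ * τ)) (a + t + j * (σ * τ)) (j * (σ * τ))
    rw [add_sub_cancel_right, add_sub_cancel_right] at hsh
    calc _ = ∫⁻ x in Icc (a + j * (σ * τ)) (a + t + j * (σ * τ)), ω x :=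
          setLIntegral_congr Ioc_ae_eq_Icc
      _ = ∫⁻ x in Icc a (a + t), ω (x + j * (σ * τ)) := hsh.symm
      _ ≤ ∫⁻ x in Icc a (a + t), C ^ 3 * ω x := lintegral_mono fun x =>
          (hiter j x).trans (mul_le_mul_left (pow_le_pow_right₀ hC1 hj) _)
      _ = C ^ 3 * ∫⁻ x in Icc a (a + t), ω x := lintegral_const_mul' _ _ (by simp [hC])
      _ = _ := by rw [setLIntegral_congr Ioc_ae_eq_Icc]
  have hcov : Ioc (a + σ * t) (a + σ * t + t) ⊆
      Ioc (a + (1 : ℕ) * (σ * τ)) (a + t + (1 : ℕ) * (σ * τ)) ∪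
      (Ioc (a + (2 : ℕ) * (σ * τ)) (a + t + (2 : ℕ) * (σ * τ)) ∪
      Ioc (a + (3 : ℕ) * (σ * τ)) (a + t + (3 : ℕ) * (σ * τ))) := by
    intro x hx
    have hx1 := hx.1
    have hx2 := hx.2
    have hσ' : σ = 1 ∨ σ = -1 := by
      rcases abs_choice σ with h' | h'
      · left; linarith
      · right; linarith
    simp only [mem_union, mem_Ioc]
    push_cast
    rcases hσ' with rfl | rfl
    · by_cases h1 : x ≤ a + t + 1 * (1 * τ)
      · left; constructor <;> linarith
      by_cases h2 : x ≤ a + t + 2 * (1 * τ)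
      · right; left; constructor <;> linarith
      · right; right; constructor <;> linarith
    · by_cases h1 : a + 1 * (-1 * τ) < x
      · left; constructor <;> linarith
      by_cases h2 : a + 2 * (-1 * τ) < x
      · right; left; constructor <;> linarith
      · right; right; constructor <;> linarith
  calc _ ≤ _ := lintegral_mono_set hcov
    _ ≤ _ := lintegral_union_le _ _ _
    _ ≤ _ := add_le_add_right (lintegral_union_le _ _ _) _
    _ ≤ C ^ 3 * (∫⁻ x in Ioc a (a + t), ω x) + (C ^ 3 * (∫⁻ x in Ioc a (a + t), ω x) +
        C ^ 3 * ∫⁻ x in Ioc a (a + t), ω x) :=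
        add_le_add (hpiece 1 (by norm_num)) (add_le_add (hpiece 2 (by norm_num))
          (hpiece 3 (by norm_num)))
    _ = _ := by ring

variable {ε : ℝ} {N : ℕ → ℕ}

theorem maximalFn_rieszSum_periodic (ε : ℝ) (N : ℕ → ℕ) :
    Function.Periodic (maximalFn (rieszSum ε N)) (2 * π) := by
  rw [maximalFn_eq_avgSup]
  exact avgSup_periodic fun x => by simp only [rieszSum_periodic ε N x]

theorem setLIntegral_maximalFn_rieszSum_ne_top (hε0 : 0 < ε) (hε1 : ε < 1) (N : ℕ → ℕ) (a b : ℝ) :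
    ∫⁻ x in Ioc a b, maximalFn (rieszSum ε N) x ≠ ∞ := by
  have h := setLIntegral_maximalFn_ne_top_of_periodic Real.two_pi_pos
    (measurable_rieszSum hε0 hε1 N) (rieszSum_periodic ε N) (by
      have := lintegral_llogl_rieszSum_le hε0 hε1 N
      rw [periodMeasure, setLIntegral_Ico_eq_Ioc] at this
      rw [zero_add]
      exact ne_top_of_le_ne_top (by simp) this)
  obtain ⟨n, hn⟩ := exists_nat_ge ((b - a) / (2 * π))
  rw [div_le_iff₀ Real.two_pi_pos] at hn
  refine ne_top_of_le_ne_top ?_ (lintegral_mono_set (Ioc_subset_Ioc_right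
    (show b ≤ a + n * (2 * π) by linarith)))
  rw [(maximalFn_rieszSum_periodic ε N).setLIntegral_Ioc_nat_mul Real.two_pi_pos]
  exact ENNReal.mul_ne_top (by simp) h

theorem measurable_maximalFn (g : ℝ → ℝ) : Measurable (maximalFn g) := measurable_avgSup _

theorem ae_maximalFn_rieszSum_lt_top (hε0 : 0 < ε) (hε1 : ε < 1) (N : ℕ → ℕ) :
    ∀ᵐ x : ℝ, maximalFn (rieszSum ε N) x < ∞ := by
  refine ae_of_ae_periodMeasure (fun x k h => ?_) ?_
  · rwa [(maximalFn_rieszSum_periodic ε N).int_mul k x] at h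
  · refine ae_lt_top (measurable_maximalFn _) ?_
    rw [periodMeasure, setLIntegral_Ico_eq_Ioc]
    exact setLIntegral_maximalFn_rieszSum_ne_top hε0 hε1 N _ _

/-- The first term alone is bounded below, each factor being at least `1 - ε`. The bound makes the
lift strictly increasing and `log ω` bounded below. -/
theorem exists_le_maximalFn_rieszSum (hε0 : 0 < ε) (hε1 : ε < 1) (N : ℕ → ℕ) :
    ∃ κ : ℝ, 0 < κ ∧ ∀ x, ENNReal.ofReal κ ≤ maximalFn (rieszSum ε N) x := by
  have hL := one_le_llogLNorm_rieszProd ε (N 1)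
  have h1ε : 0 < 1 - ε := by linarith
  refine ⟨(2 : ℝ)⁻¹ ^ 1 * ((1 - ε) ^ (N 1 + 1) / llogLNorm (rieszProd ε (N 1))), by positivity, ?_⟩
  refine ofReal_le_avgSup_of_ae_le (g := fun _ => _) continuous_const ?_
  filter_upwards [ae_summable_rieszTerm hε0 hε1 N] with x hx
  rw [Real.enorm_eq_ofReal_abs, abs_of_nonneg (rieszSum_nonneg hε0 hε1 N x)]
  refine ENNReal.ofReal_le_ofReal (le_trans ?_ (hx.le_tsum 0
    (fun j _ => (rieszTerm_pos hε0 hε1 N _ x).le)))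
  have : (1 - ε) ^ (N 1 + 1) ≤ rieszProd ε (N 1) x := by
    have h := Finset.prod_le_prod (s := Finset.range (N 1 + 1)) (f := fun _ => 1 - ε)
      (g := fun j => 1 + ε * Real.cos (3 ^ j * x)) (fun _ _ => h1ε.le)
      (fun j _ => one_sub_le_one_add_mul_cos hε0 _)
    simpa [rieszProd] using h
  simp only [rieszTerm, zero_add]
  gcongr

/-- Each partial sum is a continuous minorant, hence below the maximal function everywhere; Lebesgue
differentiation is not needed. -/
theorem enorm_rieszSum_le_maximalFn (hε0 : 0 < ε) (hε1 : ε < 1) (N : ℕ → ℕ) {x : ℝ}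
    (hx : Summable fun n : ℕ => rieszTerm ε N (n + 1) x) :
    ‖rieszSum ε N x‖ₑ ≤ maximalFn (rieszSum ε N) x := by
  rw [Real.enorm_eq_ofReal_abs, abs_of_nonneg (rieszSum_nonneg hε0 hε1 N x), rieszSum,
    ENNReal.ofReal_tsum_of_nonneg (fun n => (rieszTerm_pos hε0 hε1 N _ x).le) hx,
    ENNReal.tsum_eq_iSup_sum]
  refine iSup_le fun s => ?_
  rw [← ENNReal.ofReal_sum_of_nonneg fun n _ => (rieszTerm_pos hε0 hε1 N _ x).le]
  refine ofReal_le_avgSup_of_ae_le (g := fun x => ∑ n ∈ s, rieszTerm ε N (n + 1) x)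
    (continuous_finsetSum _ fun n _ => continuous_rieszTerm ε N _) ?_ x
  filter_upwards [ae_summable_rieszTerm hε0 hε1 N] with t ht
  rw [Real.enorm_eq_ofReal_abs, abs_of_nonneg (rieszSum_nonneg hε0 hε1 N t)]
  exact ENNReal.ofReal_le_ofReal (ht.sum_le_tsum s
    (fun j _ => (rieszTerm_pos hε0 hε1 N _ t).le))

theorem maximalFn_rieszSum_add_le (hε0 : 0 < ε) (hε1 : ε < 1) (N : ℕ → ℕ) (k : ℕ) {τ : ℝ}
    (hτ : |τ| = 2 * π / 3 ^ k) (x : ℝ) :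
    maximalFn (rieszSum ε N) (x + τ) ≤
      ENNReal.ofReal (Real.exp (ε / (1 - ε) * π)) * maximalFn (rieszSum ε N) x := by
  refine avgSup_add_le ENNReal.ofReal_ne_top (fun t => ?_) x
  simp only [Real.enorm_eq_ofReal_abs, abs_of_nonneg (rieszSum_nonneg hε0 hε1 N _)]
  rw [← ENNReal.ofReal_mul (Real.exp_pos _).le]
  exact ENNReal.ofReal_le_ofReal (rieszSum_add_le hε0 hε1 N k hτ t)

end periodic

/-! ### Circle homeomorphisms from lifts, and mean oscillation. -/

section circle
open Set Filter Topology
open scoped ENNReal Real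

theorem Circle.exists_arg_exp (x : ℝ) : ∃ k : ℤ, Complex.arg (Circle.exp x) = x + k * (2 * π) :=
  Circle.exp_eq_exp.1 (Circle.exp_arg (Circle.exp x))

theorem add_int_mul_of_add {G : ℝ → ℝ} {T : ℝ} (hG : ∀ x, G (x + T) = G x + T) (x : ℝ) (k : ℤ) :
    G (x + k * T) = G x + k * T := by
  have hp : Function.Periodic (fun x => G x - x) T := fun x => by simp only [hG]; ring
  have h : G (x + k * T) - (x + k * T) = G x - x := hp.int_mul k x
  linarith

theorem Circle.continuous_of_comp_exp {X : Type*} [TopologicalSpace X] {f : Circle → X}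
    (h : Continuous fun x : ℝ => f (Circle.exp x)) : Continuous f :=
  (isLocalHomeomorph_circleExp.isOpenMap.isQuotientMap Circle.exp.continuous
    Circle.exp_surjective).continuous_iff.2 h

/-- A strictly increasing continuous lift of degree one induces a homeomorphism of the circle. -/
theorem exists_circle_homeomorph_of_lift {G : ℝ → ℝ} (hc : Continuous G) (hm : StrictMono G)
    (hG : ∀ x, G (x + 2 * π) = G x + 2 * π) :
    ∃ h : Circle ≃ₜ Circle, ∀ x, h (Circle.exp x) = Circle.exp (G x) := by
  let f : Circle → Circle := fun z => Circle.exp (G (Complex.arg z))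
  have hf : ∀ x, f (Circle.exp x) = Circle.exp (G x) := fun x => by
    obtain ⟨k, hk⟩ := Circle.exists_arg_exp x
    simp only [f, hk, add_int_mul_of_add hG]
    exact Circle.exp_eq_exp.2 ⟨k, rfl⟩
  have hfc : Continuous f := Circle.continuous_of_comp_exp (by simp only [hf]; fun_prop)
  have hinj : Function.Injective f := by
    intro z w hzw
    obtain ⟨x, rfl⟩ := Circle.exp_surjective z
    obtain ⟨y, rfl⟩ := Circle.exp_surjective w
    rw [hf, hf, Circle.exp_eq_exp] at hzw
    obtain ⟨m, hm'⟩ := hzw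
    rw [← add_int_mul_of_add hG] at hm'
    exact Circle.exp_eq_exp.2 ⟨m, hm.injective hm'⟩
  have hGs : Function.Surjective G := by
    intro y
    have hk : ∀ k : ℤ, G (0 + k * (2 * π)) = G 0 + k * (2 * π) := add_int_mul_of_add hG 0
    have h2π := Real.two_pi_pos
    refine mem_range_of_exists_le_of_exists_ge hc
      ⟨0 + (⌊(y - G 0) / (2 * π)⌋ : ℤ) * (2 * π), ?_⟩
      ⟨0 + (⌈(y - G 0) / (2 * π)⌉ : ℤ) * (2 * π), ?_⟩
    · have := Int.floor_le ((y - G 0) / (2 * π))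
      rw [le_div_iff₀ h2π] at this
      rw [hk]; linarith
    · have := Int.le_ceil ((y - G 0) / (2 * π))
      rw [div_le_iff₀ h2π] at this
      rw [hk]; linarith
  have hsurj : Function.Surjective f := by
    intro w
    obtain ⟨y, rfl⟩ := Circle.exp_surjective w
    obtain ⟨x, rfl⟩ := hGs y
    exact ⟨Circle.exp x, hf x⟩
  exact ⟨hfc.homeoOfEquivCompactToT2 (f := Equiv.ofBijective f ⟨hinj, hsurj⟩), hf⟩

theorem Circle.dist_exp_le (a b : ℝ) : dist (Circle.exp a) (Circle.exp b) ≤ dist a b := by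
  change dist (Circle.exp a : ℂ) (Circle.exp b : ℂ) ≤ ‖a - b‖
  rw [dist_eq_norm, Circle.coe_exp, Circle.coe_exp]
  have h : Complex.exp (a * Complex.I) - Complex.exp (b * Complex.I) =
      Complex.exp (b * Complex.I) * (Complex.exp (Complex.I * ((a - b : ℝ) : ℂ)) - 1) := by
    rw [mul_sub, ← Complex.exp_add]
    push_cast; ring_nf
  rw [h, norm_mul, Complex.norm_exp_ofReal_mul_I, one_mul]
  exact Real.norm_exp_I_mul_ofReal_sub_one_le

theorem circleAC_of_lift {h : Circle ≃ₜ Circle} {G : ℝ → ℝ}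
    (hh : ∀ x, h (Circle.exp x) = Circle.exp (G x))
    (hG : AbsolutelyContinuousOnInterval G 0 (2 * π)) : CircleAC h := by
  unfold CircleAC AbsolutelyContinuousOnInterval
  refine squeeze_zero (fun E => Finset.sum_nonneg fun _ _ => dist_nonneg) (fun E => ?_) hG
  refine Finset.sum_le_sum fun i _ => ?_
  simp only [hh]
  exact Circle.dist_exp_le _ _

/-- Differentiating `e^{iG}` and dividing by `i e^{ix}` shows that, for `g' > 0`, `G(x) - x` is an
argument of `h'`. The definition differentiates at `arg`, which differs from `x` by a period. -/
theorem circleDeriv_exp_of_lift {h : Circle ≃ₜ Circle} {G : ℝ → ℝ}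
    (hh : ∀ x, h (Circle.exp x) = Circle.exp (G x)) {x g' : ℝ} (hx : HasDerivAt G g' x) :
    circleDeriv h (Circle.exp x) = g' * Complex.exp (((G x - x : ℝ) : ℂ) * Complex.I) := by
  set φ : ℝ → ℂ := fun x => (h (Circle.exp x) : ℂ) with hφ
  have hper : Function.Periodic φ (2 * π) := fun t => by simp only [hφ, Circle.exp_add_two_pi]
  obtain ⟨k, hk⟩ := Circle.exists_arg_exp x
  have h1 : deriv φ (x + k * (2 * π)) = deriv φ x := by
    rw [← deriv_comp_add_const]
    congr 1
    ext t
    exact hper.int_mul k t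
  have h2 : HasDerivAt φ (Complex.exp (G x * Complex.I) * (g' * Complex.I)) x := by
    have : φ = fun t => Complex.exp (G t * Complex.I) := by
      ext t; simp only [hφ, hh, Circle.coe_exp]
    rw [this]
    exact (hx.ofReal_comp.mul_const Complex.I).cexp
  rw [circleDeriv, hk, h1, h2.deriv, Circle.coe_exp]
  have h3 : Complex.exp (((G x - x : ℝ) : ℂ) * Complex.I) * Complex.exp (x * Complex.I) =
      Complex.exp (G x * Complex.I) := by
    rw [← Complex.exp_add]; push_cast; ring_nf
  rw [div_eq_iff (mul_ne_zero Complex.I_ne_zero (Complex.exp_ne_zero _)), ← h3]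
  ring

/-- A periodic, locally integrable, almost everywhere positive function is, up to a constant, the
derivative of an absolutely continuous circle homeomorphism. -/
theorem exists_circle_homeomorph_of_density {W : ℝ → ℝ} (hW : LocallyIntegrable W)
    (hper : Function.Periodic W (2 * π)) (hpos : ∀ᵐ x, 0 < W x) :
    ∃ (h : Circle ≃ₜ Circle) (c : ℝ) (G : ℝ → ℝ), 0 < c ∧ Continuous G ∧
      (∀ x, G (x + 2 * π) = G x + 2 * π) ∧ SensePreserving h ∧ CircleAC h ∧
      ∀ᵐ x : ℝ, circleDeriv h (Circle.exp x) =
        (c * W x : ℝ) * Complex.exp (((G x - x : ℝ) : ℂ) * Complex.I) := by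
  have hint : ∀ a b, IntervalIntegrable W volume a b := fun a b =>
    intervalIntegrable_iff.2 ((hW.integrableOn_isCompact isCompact_uIcc).mono_set uIoc_subset_uIcc)
  have hpos' : ∀ a b, a < b → 0 < ∫ t in a..b, W t := by
    intro a b hab
    rw [intervalIntegral.integral_pos_iff_support_of_nonneg_ae
      (hpos.mono fun x hx => hx.le) (hint a b)]
    refine ⟨hab, ?_⟩
    have : (Function.support W ∩ Ioc a b : Set ℝ) =ᵐ[volume] Ioc a b := by
      filter_upwards [hpos] with x hx
      exact propext ⟨fun h => h.2, fun h => ⟨hx.ne', h⟩⟩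
    rw [measure_congr this]
    simpa using hab
  set S := ∫ t in (0 : ℝ)..2 * π, W t with hS
  have hS0 : 0 < S := hpos' _ _ Real.two_pi_pos
  -- Normalizes the lift to degree one.
  set c := 2 * π / S with hc
  have hc0 : 0 < c := by positivity
  set G : ℝ → ℝ := fun x => c * ∫ t in (0 : ℝ)..x, W t with hG
  have hGc : Continuous G := (intervalIntegral.continuous_primitive hint 0).const_mul c
  have hGm : StrictMono G := by
    intro x y hxy
    have h1 := intervalIntegral.integral_interval_sub_left (hint 0 y) (hint 0 x)
    have h2 := hpos' x y hxy
    simp only [hG]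
    gcongr
    linarith
  have hGp : ∀ x, G (x + 2 * π) = G x + 2 * π := by
    intro x
    have h1 := intervalIntegral.integral_add_adjacent_intervals (hint 0 x) (hint x (x + 2 * π))
    have h2 := hper.intervalIntegral_add_eq x 0
    rw [zero_add, ← hS] at h2
    simp only [hG]
    rw [← h1, h2, mul_add, hc, div_mul_cancel₀ _ hS0.ne']
  obtain ⟨h, hh⟩ := exists_circle_homeomorph_of_lift hGc hGm hGp
  refine ⟨h, c, G, hc0, hGc, hGp, ⟨G, hGc, hGm, hh⟩, ?_, ?_⟩
  · refine circleAC_of_lift hh ?_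
    have := (hint 0 (2 * π)).absolutelyContinuousOnInterval_intervalIntegral (c := 0)
      (by simp [Real.pi_pos.le])
    exact this.const_mul c
  · filter_upwards [LocallyIntegrable.ae_hasDerivAt_integral hW] with x hx
    exact circleDeriv_exp_of_lift hh ((hx 0).const_mul c)

/-- Mean oscillation may be tested against any constant in place of the mean, at the cost of a
factor 2. -/
theorem average_norm_sub_average_le {v : ℝ → ℂ} {a b D : ℝ} (hab : a < b)
    (hv : IntervalIntegrable v volume a b) (κ : ℂ)
    (h : ∫ x in a..b, ‖v x - κ‖ ≤ D * (b - a)) :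
    (⨍ x in a..b, ‖v x - ⨍ y in a..b, v y‖) ≤ 2 * D := by
  have hba : 0 < b - a := by linarith
  set A := ⨍ y in a..b, v y with hA
  have hsub : IntervalIntegrable (fun x => v x - κ) volume a b :=
    hv.sub intervalIntegrable_const
  have hAκ : ‖A - κ‖ ≤ D := by
    have h1 : A - κ = (b - a)⁻¹ • ∫ x in a..b, (v x - κ) := by
      rw [intervalIntegral.integral_sub hv intervalIntegrable_const,
        intervalIntegral.integral_const, smul_sub, hA, interval_average_eq, smul_smul,
        inv_mul_cancel₀ hba.ne', one_smul]
    rw [h1, norm_smul, norm_inv, Real.norm_of_nonneg hba.le, inv_mul_le_iff₀ hba, mul_comm]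
    exact (intervalIntegral.norm_integral_le_integral_norm hab.le).trans h
  rw [interval_average_eq, smul_eq_mul, inv_mul_le_iff₀ hba]
  calc ∫ x in a..b, ‖v x - A‖ ≤ ∫ x in a..b, (‖v x - κ‖ + ‖A - κ‖) := by
        refine intervalIntegral.integral_mono_on hab.le
          (hv.sub intervalIntegrable_const).norm (hsub.norm.add intervalIntegrable_const)
          fun x _ => ?_
        have : v x - A = (v x - κ) - (A - κ) := by ring
        rw [this]
        exact norm_sub_le _ _
    _ = (∫ x in a..b, ‖v x - κ‖) + (b - a) * ‖A - κ‖ := by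
        rw [intervalIntegral.integral_add hsub.norm intervalIntegrable_const,
          intervalIntegral.integral_const, smul_eq_mul]
    _ ≤ (b - a) * (2 * D) := by nlinarith

end circle

/-! ### The weight on the circle: doubling, logarithm, and `A_∞`. -/

section main
open Set Filter Topology
open scoped ENNReal Real

theorem integrableOn_toReal_of_setLIntegral_ne_top {ω : ℝ → ℝ≥0∞} (hω : Measurable ω) {E : Set ℝ}
    (hE : ∫⁻ x in E, ω x ≠ ∞) : IntegrableOn (fun x => (ω x).toReal) E :=
  integrable_toReal_of_lintegral_ne_top hω.aemeasurable hE

theorem setIntegral_weight_eq {ω : ℝ → ℝ≥0∞} {w : Circle → ℝ} {c : ℝ} (hω : Measurable ω)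
    (hw : ∀ᵐ x : ℝ, w (Circle.exp x) = c * (ω x).toReal) {E : Set ℝ}
    (hE : ∫⁻ x in E, ω x ≠ ∞) :
    ∫ x in E, w (Circle.exp x) = c * (∫⁻ x in E, ω x).toReal := by
  rw [integral_congr_ae (ae_restrict_of_ae hw), integral_const_mul,
    integral_toReal hω.aemeasurable (ae_lt_top hω hE)]

theorem isWeight_of_ae_eq {ω : ℝ → ℝ≥0∞} {w : Circle → ℝ} {c : ℝ} (hc : 0 < c)
    (hω : Measurable ω) (hw : ∀ᵐ x : ℝ, w (Circle.exp x) = c * (ω x).toReal)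
    (hw0 : ∀ z, 0 ≤ w z) (hfin : ∀ a b, ∫⁻ x in Ioc a b, ω x ≠ ∞) (hpos : ∀ x, 0 < ω x) :
    IsWeight w := by
  have hfin' : ∫⁻ x in Ico 0 (2 * π), ω x ≠ ∞ := by
    rw [setLIntegral_Ico_eq_Ioc]; exact hfin _ _
  refine ⟨hw0, ?_, ?_⟩
  · exact ((integrableOn_toReal_of_setLIntegral_ne_top hω hfin').const_mul c).congr
      (ae_restrict_of_ae (hw.mono fun x hx => hx.symm))
  · rw [periodMeasure, setIntegral_weight_eq hω hw hfin']
    refine mul_pos hc (ENNReal.toReal_pos ?_ hfin')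
    rw [← pos_iff_ne_zero, setLIntegral_pos_iff hω]
    have : Function.support ω = univ := eq_univ_of_forall fun x => (hpos x).ne'
    rw [this, univ_inter, Real.volume_Ico]
    simp [Real.pi_pos]

theorem isDoublingWeight_of_quasiInvariant {ω : ℝ → ℝ≥0∞} {w : Circle → ℝ} {c : ℝ} (hc : 0 < c)
    (hω : Measurable ω) (hw : ∀ᵐ x : ℝ, w (Circle.exp x) = c * (ω x).toReal)
    (hw0 : ∀ z, 0 ≤ w z) (hfin : ∀ a b, ∫⁻ x in Ioc a b, ω x ≠ ∞) (hpos : ∀ x, 0 < ω x)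
    {C : ℝ≥0∞} (hC1 : 1 ≤ C) (hC : C ≠ ∞)
    (h : ∀ (k : ℕ) (τ : ℝ), |τ| = 2 * π / 3 ^ k → ∀ x, ω (x + τ) ≤ C * ω x) :
    IsDoublingWeight w := by
  refine ⟨isWeight_of_ae_eq hc hω hw hw0 hfin hpos, (3 * C ^ 3).toReal, ?_, fun a t ht0 htπ => ?_⟩
  · refine ENNReal.toReal_pos ?_ (by finiteness)
    have : C ≠ 0 := (zero_lt_one.trans_le hC1).ne'
    positivity
  have hD : 0 < (3 * C ^ 3).toReal := by
    refine ENNReal.toReal_pos ?_ (by finiteness)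
    have : C ≠ 0 := (zero_lt_one.trans_le hC1).ne'
    positivity
  have hle : ∀ {a b a' b'}, ∫⁻ x in Ioc a b, ω x ≤ 3 * C ^ 3 * ∫⁻ x in Ioc a' b', ω x →
      ∫ x in Ioc a b, w (Circle.exp x) ≤
        (3 * C ^ 3).toReal * ∫ x in Ioc a' b', w (Circle.exp x) := by
    intro a b a' b' hab
    rw [setIntegral_weight_eq hω hw (hfin _ _), setIntegral_weight_eq hω hw (hfin _ _)]
    have := ENNReal.toReal_mono (ENNReal.mul_ne_top (by finiteness) (hfin _ _)) hab
    rw [ENNReal.toReal_mul] at this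
    calc _ ≤ _ := mul_le_mul_of_nonneg_left this hc.le
      _ = _ := by ring
  rw [intervalIntegral.integral_of_le (by linarith), intervalIntegral.integral_of_le (by linarith)]
  have h1 := setLIntegral_Ioc_add_le_of_quasiInvariant hC1 hC h (a := a) ht0 htπ (σ := 1) (by simp)
  have h2 := setLIntegral_Ioc_add_le_of_quasiInvariant hC1 hC h (a := a + t) ht0 htπ (σ := -1)
    (by simp)
  rw [one_mul, show a + t + t = a + 2 * t by ring] at h1
  rw [show a + t + -1 * t = a by ring, show a + t + t = a + 2 * t by ring] at h2
  refine ⟨?_, hle h1⟩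
  rw [inv_mul_le_iff₀ hD]
  exact hle h2

/-- The comparison constant on `[a, b]` is `log (c m)` with `m` the infimum of the maximal function
there. The real part then contributes 16 and the bounded imaginary part `K`; `κ` keeps the logarithm
integrable from below. -/
theorem circleBMO_log_add_arg {F : ℝ → ℝ≥0∞} (hfin : ∀ a b, ∫⁻ x in Ioc a b, avgSup F x ≠ ∞)
    (hae : ∀ᵐ x, avgSup F x < ∞) {κ : ℝ} (hκ : 0 < κ)
    (hκF : ∀ x, ENNReal.ofReal κ ≤ avgSup F x) {c : ℝ} (hc : 0 < c) {θ : ℝ → ℝ}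
    (hθ : Continuous θ) {K : ℝ} (hK : ∀ x, |θ x| ≤ K) {u : Circle → ℂ}
    (hu : ∀ x, u (Circle.exp x) =
      (Real.log (c * (avgSup F x).toReal) : ℂ) + (θ x : ℂ) * Complex.I) :
    CircleBMO u := by
  have hω := measurable_avgSup F
  have hWκ : ∀ᵐ x, κ ≤ (avgSup F x).toReal := by
    filter_upwards [hae] with x hx
    exact (ENNReal.ofReal_le_iff_le_toReal hx.ne).1 (hκF x)
  have hWint : ∀ a b, IntegrableOn (fun x => (avgSup F x).toReal) (Ioc a b) := fun a b =>
    integrableOn_toReal_of_setLIntegral_ne_top hω (hfin a b)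
  have hlogm : Measurable fun x => Real.log (c * (avgSup F x).toReal) :=
    Real.measurable_log.comp (hω.ennreal_toReal.const_mul c)
  have hlogint : ∀ a b, IntegrableOn (fun x => Real.log (c * (avgSup F x).toReal)) (Ioc a b) := by
    intro a b
    refine Integrable.mono' (((hWint a b).const_mul c).add
      (integrable_const (|Real.log (c * κ)|))) hlogm.aestronglyMeasurable ?_
    filter_upwards [ae_restrict_of_ae hWκ] with x hx
    have h1 : Real.log (c * κ) ≤ Real.log (c * (avgSup F x).toReal) :=
      Real.log_le_log (by positivity) (by gcongr)
    have h2 := Real.log_le_self (show 0 ≤ c * (avgSup F x).toReal by positivity)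
    have h3 := neg_abs_le (Real.log (c * κ))
    have h4 := abs_nonneg (Real.log (c * κ))
    have h5 : 0 ≤ c * (avgSup F x).toReal := by positivity
    simp only [Real.norm_eq_abs, Pi.add_apply]
    rw [abs_le]
    constructor <;> linarith
  have huint : ∀ a b, IntegrableOn (fun x : ℝ => u (Circle.exp x)) (Ioc a b) := by
    intro a b
    simp only [hu]
    refine (hlogint a b).ofReal.add ?_
    exact (Continuous.integrableOn_Ioc (by fun_prop))
  refine ⟨?_, 2 * (16 + K), fun a b hab _ => ?_⟩
  · exact (huint 0 (2 * π)).congr_set_ae Ico_ae_eq_Ioc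
  set m := ⨅ y ∈ Icc a b, avgSup F y with hm
  have hmκ : ENNReal.ofReal κ ≤ m := le_iInf₂ fun y _ => hκF y
  have hm0 : m ≠ 0 := ((ENNReal.ofReal_pos.2 hκ).trans_le hmκ).ne'
  have hmt : m ≠ ∞ := by
    have : (ae (volume.restrict (Icc a b))).NeBot := by
      rw [ae_neBot, Ne, Measure.restrict_eq_zero]
      simpa using hab
    obtain ⟨y, hy, hymem⟩ := ((ae_restrict_of_ae hae).and
      (ae_restrict_mem measurableSet_Icc : ∀ᵐ y ∂volume.restrict (Icc a b), y ∈ Icc a b)).exists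
    exact ((iInf₂_le y hymem).trans_lt hy).ne
  have hmpos : 0 < m.toReal := ENNReal.toReal_pos hm0 hmt
  have hosc := setLIntegral_log_avgSup_le F hab hm hm0 hmt
  have hosc' : ∫⁻ x in Ioc a b, ENNReal.ofReal (Real.log (avgSup F x / m).toReal) ≤
      ENNReal.ofReal (16 * (b - a)) := by
    rw [ENNReal.ofReal_mul (by norm_num), ENNReal.ofReal_ofNat]
    exact (lintegral_mono_set Ioc_subset_Icc_self).trans hosc
  have hratio : ∀ᵐ x, x ∈ Ioc a b → 0 ≤ Real.log (avgSup F x / m).toReal ∧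
      Real.log (c * (avgSup F x).toReal) - Real.log (c * m.toReal) =
        Real.log (avgSup F x / m).toReal := by
    filter_upwards [hae, hWκ] with x hx hxκ hxab
    have hmx : m ≤ avgSup F x := iInf₂_le x (Ioc_subset_Icc_self hxab)
    have hmx' := ENNReal.toReal_mono hx.ne hmx
    rw [ENNReal.toReal_div]
    refine ⟨Real.log_nonneg ?_, ?_⟩
    · rwa [le_div_iff₀ hmpos, one_mul]
    · rw [Real.log_mul hc.ne' (by linarith), Real.log_mul hc.ne' hmpos.ne',
        Real.log_div (by linarith) hmpos.ne']
      ring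
  have hgm : Measurable fun x => Real.log (avgSup F x / m).toReal :=
    Real.measurable_log.comp (hω.div_const m).ennreal_toReal
  have hg0 : 0 ≤ᵐ[volume.restrict (Ioc a b)] fun x => Real.log (avgSup F x / m).toReal :=
    (ae_restrict_iff' measurableSet_Ioc).2 (hratio.mono fun x hx hxab => (hx hxab).1)
  have hgint : IntegrableOn (fun x => Real.log (avgSup F x / m).toReal) (Ioc a b) := by
    refine ⟨hgm.aestronglyMeasurable, ?_⟩
    rw [hasFiniteIntegral_iff_ofReal hg0]
    exact hosc'.trans_lt ENNReal.ofReal_lt_top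
  have hgle : ∫ x in Ioc a b, Real.log (avgSup F x / m).toReal ≤ 16 * (b - a) := by
    rw [integral_eq_lintegral_of_nonneg_ae hg0 hgm.aestronglyMeasurable]
    exact ENNReal.toReal_le_of_le_ofReal (by linarith) hosc'
  refine average_norm_sub_average_le hab
    ((intervalIntegrable_iff_integrableOn_Ioc_of_le hab.le).2 (huint a b))
    (Real.log (c * m.toReal) : ℂ) ?_
  rw [intervalIntegral.integral_of_le hab.le]
  calc ∫ x in Ioc a b, ‖u (Circle.exp x) - (Real.log (c * m.toReal) : ℂ)‖
      ≤ ∫ x in Ioc a b, (Real.log (avgSup F x / m).toReal + K) := by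
        refine setIntegral_mono_on_ae ?_ (hgint.add (integrable_const K)) measurableSet_Ioc ?_
        · exact ((huint a b).sub (integrable_const _)).norm
        · filter_upwards [hratio] with x hx hxab
          obtain ⟨h1, h2⟩ := hx hxab
          have h3 : u (Circle.exp x) - (Real.log (c * m.toReal) : ℂ) =
              ((Real.log (avgSup F x / m).toReal : ℝ) : ℂ) + (θ x : ℂ) * Complex.I := by
            rw [hu, ← h2]; push_cast; ring
          rw [h3]
          refine (norm_add_le _ _).trans (add_le_add ?_ ?_)
          · rw [Complex.norm_real, Real.norm_of_nonneg h1]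
          · rw [norm_mul, Complex.norm_I, mul_one, Complex.norm_real]
            exact hK x
    _ = (∫ x in Ioc a b, Real.log (avgSup F x / m).toReal) + (b - a) * K := by
        rw [integral_add hgint (integrable_const K)]
        simp [hab.le]
    _ ≤ (16 + K) * (b - a) := by linarith

/-- The period is cut at a point `p` where the maximal function is finite: by periodicity it has the
same value at `p + 2π`, and this value is the starting level of the self-improvement. Taking `η =
1/2` gives the factor 2 there. -/
theorem exists_setLIntegral_rpow_ne_top_of_isAInftyWeight {F : ℝ → ℝ≥0∞} {w : Circle → ℝ} {c : ℝ}
    (hc : 0 < c) (hF : Function.Periodic F (2 * π))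
    (hw : ∀ᵐ x : ℝ, w (Circle.exp x) = c * (avgSup F x).toReal)
    (hfin : ∀ a b, ∫⁻ x in Ioc a b, avgSup F x ≠ ∞) (hpos : ∀ x, 0 < avgSup F x)
    (hae : ∀ᵐ x, avgSup F x < ∞) (hA : IsAInftyWeight w) :
    ∃ s : ℝ, 0 < s ∧ ∫⁻ x in Ico 0 (2 * π), avgSup F x ^ (1 + s) ≠ ∞ := by
  have hω := measurable_avgSup F
  have hper := avgSup_periodic hF
  obtain ⟨p, hp⟩ := hae.exists
  obtain ⟨δ, hδ, hAδ⟩ := hA.2 (1 / 2) (by norm_num)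
  have hIoo : ∀ a b, ∫⁻ x in Ioo a b, avgSup F x = ∫⁻ x in Ioc a b, avgSup F x := fun a b =>
    setLIntegral_congr Ioo_ae_eq_Ioc
  obtain ⟨s, hs, hsint⟩ := exists_setLIntegral_rpow_ne_top (F := F) (p := p) (q := p + 2 * π) hδ
    (l := avgSup F p) (hpos p).ne' hp.ne le_rfl (hper p).le (by
      intro a b hpa hab hbq E hE hEab hEvol
      have hfE : ∫⁻ x in E, avgSup F x ≠ ∞ :=
        ne_top_of_le_ne_top (hfin a b) (lintegral_mono_set (hEab.trans Ioo_subset_Ioc_self))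
      have h := hAδ a b hab (by linarith) E hE (hEab.trans Ioo_subset_Ioc_self) hEvol
      rw [intervalIntegral.integral_of_le hab.le, setIntegral_weight_eq hω hw hfE,
        setIntegral_weight_eq hω hw (hfin a b)] at h
      have h2 : 2 * (∫⁻ x in E, avgSup F x).toReal ≤ (∫⁻ x in Ioc a b, avgSup F x).toReal := by
        have h3 : c * (2 * (∫⁻ x in E, avgSup F x).toReal) ≤
            c * (∫⁻ x in Ioc a b, avgSup F x).toReal := by linarith
        exact le_of_mul_le_mul_left h3 hc
      rw [hIoo, ← ENNReal.toReal_le_toReal (by finiteness) (hfin a b), ENNReal.toReal_mul]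
      simpa using h2) (by rw [hIoo]; exact hfin _ _)
  refine ⟨s, hs, ?_⟩
  have hperp : Function.Periodic (fun x => avgSup F x ^ (1 + s)) (2 * π) := fun x => by
    simp only [hper x]
  rw [setLIntegral_Ico_eq_Ioc]
  have := hperp.setLIntegral_Ioc_eq Real.two_pi_pos 0 p
  rw [zero_add] at this
  rw [this, ← setLIntegral_congr Ioo_ae_eq_Ioc]
  exact hsint

end main

theorem theorem1 (ε : ℝ) (hε0 : 0 < ε) (hε1 : ε < 1) :
    (∃ N : ℕ → ℕ, FastGrowth ε N) ∧
    ∀ N : ℕ → ℕ, FastGrowth ε N →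
      (∀ᵐ x : ℝ, Summable fun n : ℕ => rieszTerm ε N (n + 1) x) ∧
      MemLlogL (rieszSum ε N) ∧
      (∀ p : ENNReal, 1 < p → ¬ MemLp (rieszSum ε N) p periodMeasure) ∧
      ∃ h : Circle ≃ₜ Circle,
        SensePreserving h ∧
        CircleAC h ∧
        IsDoublingWeight (fun z => ‖circleDeriv h z‖) ∧
        (∃ L : Circle → ℂ, IsLogDeriv h L ∧ CircleBMO L) ∧
        ¬ IsAInftyWeight (fun z => ‖circleDeriv h z‖) ∧
        ∃ c : ℝ, 0 < c ∧
          ∀ᵐ x : ℝ, ‖circleDeriv h (Circle.exp x)‖ₑ =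
            ENNReal.ofReal c * maximalFn (rieszSum ε N) x := by
  refine ⟨exists_fastGrowth hε0 hε1, fun N hN => ⟨ae_summable_rieszTerm hε0 hε1 N,
    memLlogL_rieszSum hε0 hε1 N, fun p hp => not_memLp_rieszSum hε0 hε1 hN hp, ?_⟩⟩
  have hω : Measurable (maximalFn (rieszSum ε N)) := measurable_maximalFn _
  have hfin := setLIntegral_maximalFn_rieszSum_ne_top hε0 hε1 N
  have hae := ae_maximalFn_rieszSum_lt_top hε0 hε1 N
  have hper := maximalFn_rieszSum_periodic ε N
  obtain ⟨κ, hκ, hκω⟩ := exists_le_maximalFn_rieszSum hε0 hε1 N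
  have hpos : ∀ x, 0 < maximalFn (rieszSum ε N) x := fun x =>
    (ENNReal.ofReal_pos.2 hκ).trans_le (hκω x)
  have hWloc : LocallyIntegrable (fun x => (maximalFn (rieszSum ε N) x).toReal) := by
    intro x
    exact ⟨Set.Ioc (x - 1) (x + 1), Ioc_mem_nhds (by linarith) (by linarith),
      integrableOn_toReal_of_setLIntegral_ne_top hω (hfin _ _)⟩
  obtain ⟨h, c, G, hc, hGc, hGp, hsp, hac, hder⟩ := exists_circle_homeomorph_of_density hWloc
    (fun x => by simp only [hper x])
    (hae.mono fun x hx => ENNReal.toReal_pos (hpos x).ne' hx.ne)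
  have hnorm : ∀ᵐ x : ℝ, ‖circleDeriv h (Circle.exp x)‖ =
      c * (maximalFn (rieszSum ε N) x).toReal := by
    filter_upwards [hder] with x hx
    rw [hx, norm_mul, Complex.norm_exp_ofReal_mul_I, mul_one, Complex.norm_real,
      Real.norm_of_nonneg (by positivity)]
  have hexp : 0 ≤ ε / (1 - ε) * Real.pi :=
    mul_nonneg (div_nonneg hε0.le (by linarith)) Real.pi_pos.le
  refine ⟨h, hsp, hac, ?_, ?_, ?_, c, hc, ?_⟩
  · refine isDoublingWeight_of_quasiInvariant hc hω hnorm (fun z => norm_nonneg _) hfin hpos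
      (C := ENNReal.ofReal (Real.exp (ε / (1 - ε) * Real.pi))) ?_ ENNReal.ofReal_ne_top
      fun k τ hτ x => maximalFn_rieszSum_add_le hε0 hε1 N k hτ x
    rw [← ENNReal.ofReal_one]
    exact ENNReal.ofReal_le_ofReal (Real.one_le_exp hexp)
  · set θ : ℝ → ℝ := fun x => G x - x with hθ
    have hθp : Function.Periodic θ (2 * Real.pi) := fun x => by simp only [hθ, hGp]; ring
    have hθc : Continuous θ := hGc.sub continuous_id
    -- On the null set where `ω = ∞` the real part is `log 0 = 0`. The imaginary part is continuous
    -- across the cut of `arg` because `θ` is periodic.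
    set L : Circle → ℂ := fun z =>
      (Real.log (c * (maximalFn (rieszSum ε N) (Complex.arg z)).toReal) : ℂ) +
        (θ (Complex.arg z) : ℂ) * Complex.I with hL
    have hLexp : ∀ x, L (Circle.exp x) =
        (Real.log (c * (maximalFn (rieszSum ε N) x).toReal) : ℂ) + (θ x : ℂ) * Complex.I := by
      intro x
      obtain ⟨k, hk⟩ := Circle.exists_arg_exp x
      simp only [hL, hk, hper.int_mul k x, hθp.int_mul k x]
    obtain ⟨K, hK⟩ : ∃ K, ∀ x, |θ x| ≤ K := by
      obtain ⟨K, hK⟩ := isCompact_Icc.exists_bound_of_continuousOn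
        (s := Set.Icc (0 : ℝ) (2 * Real.pi)) hθc.continuousOn
      refine ⟨K, fun x => ?_⟩
      obtain ⟨y, hy, hxy⟩ := hθp.exists_mem_Ico₀ Real.two_pi_pos x
      rw [hxy]
      exact hK y (Set.Ico_subset_Icc_self hy)
    refine ⟨L, ⟨?_, ?_⟩, circleBMO_log_add_arg hfin hae hκ hκω hc hθc hK hLexp⟩
    · filter_upwards [hder, hae] with x hx hxt
      have hW : 0 < (maximalFn (rieszSum ε N) x).toReal := ENNReal.toReal_pos (hpos x).ne' hxt.ne
      rw [hLexp, hx, Complex.exp_add, ← Complex.ofReal_exp, Real.exp_log (mul_pos hc hW)]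
    · refine Circle.continuous_of_comp_exp ?_
      simp only [hLexp]
      simpa using hθc
  -- An `A_∞` weight would put `ω` in `L^{1+s}` over a period, hence also `rieszSum ε N`, which is
  -- at most `ω` almost everywhere.
  · intro hA
    obtain ⟨s, hs, hsint⟩ := exists_setLIntegral_rpow_ne_top_of_isAInftyWeight hc
      (fun x => by simp only [rieszSum_periodic ε N x]) hnorm hfin hpos hae hA
    refine not_memLp_rieszSum hε0 hε1 hN (p := ENNReal.ofReal (1 + s)) ?_ ?_
    · rw [← ENNReal.ofReal_one, ENNReal.ofReal_lt_ofReal_iff] <;> linarith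
    · refine ⟨(measurable_rieszSum hε0 hε1 N).aestronglyMeasurable, ?_⟩
      rw [eLpNorm_lt_top_iff_lintegral_rpow_enorm_lt_top (by simp; linarith) ENNReal.ofReal_ne_top,
        ENNReal.toReal_ofReal (by linarith)]
      refine lt_of_le_of_lt (lintegral_mono_ae ?_) hsint.lt_top
      filter_upwards [ae_restrict_of_ae (ae_summable_rieszTerm hε0 hε1 N)] with x hx
      exact ENNReal.rpow_le_rpow (enorm_rieszSum_le_maximalFn hε0 hε1 N hx) (by linarith)
  · filter_upwards [hnorm, hae] with x hx hxt
    rw [← enorm_norm, hx, Real.enorm_of_nonneg (by positivity), ENNReal.ofReal_mul hc.le,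
      ENNReal.ofReal_toReal hxt.ne]
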